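/- Let $\nu$ be a Lévy measure on $\mathbb R$, i.e. $\nu(\{0\})=0$ and $\int_{\mathbb R}(1\wedge u^2)\,\nu(du)<\infty$, let $\beta,\sigma\in\mathbb R$, and let $X$ be a real random variable with $$\mathbb E\,e^{itX}=\exp\Big\{it\beta-\frac{\sigma^2t^2}{2}+\int_{\mathbb R}\big(e^{itu}-1-itu\mathbf 1_{\{|u|\le 1\}}\big)\nu(du)\Big\},\qquad t\in\mathbb R .$$ Let $\mathcal F_X$ be the set of bounded, infinitely differentiable $g:\mathbb R\to\mathbb R$ such that $\sup_x|x^m g^{(n)}(x)|<\infty$ for all $m,n\ge 0$ and $g^{(k)}(x)\to 0$ as $x\to\pm\infty$ for all $k\ge 0$. Then for every $g\in\mathcal F_X$ the following hold; the integrals with respect to $\nu$ that define $\mathcal A_X g(x)$ converge absolutely for every $x\in\mathbb R$. (i) (Type A) Suppose $\nu(\mathbb R)<\infty$, $\sigma^2=0$ and $\beta-\int_{|u|\le1}u\,\nu(du)=0$, and put $$\mathcal A_X g(x)=x g(x)-\int_{\mathbb R}u\,g(x+u)\,\nu(du).$$ Then $\mathbb E[\mathcal A_X g(X)]=0$ whenever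 this expectation exists, i.e. $\mathbb E|\mathcal A_Xg(X)|<\infty$. (ii) (Type B) Suppose $\nu(\mathbb R)=\infty$, $\sigma^2=0$ and $\int_{|u|\le1}|u|\,\nu(du)<\infty$, and put $\beta_\nu=\beta-\int_{|u|\le1}u\,\nu(du)$ and $$\mathcal A_X g(x)=(x-\beta_\nu) g(x)-\int_{\mathbb R}u\,g(x+u)\,\nu(du).$$ Then $\mathbb E[\mathcal A_X g(X)]=0$ whenever this expectation exists, i.e. $\mathbb E|\mathcal A_Xg(X)|<\infty$. (iii) (Type C) Suppose $\sigma^2=0$, $\int_{|u|\le1}|u|\,\nu(du)=\infty$ and $\int_{|u|>1}|u|\,\nu(du)<\infty$, and put $$\mathcal A_X g(x)=(x-\beta) g(x)-\int_{\mathbb R}u\big(g(x+u)-g(x)\mathbf 1_{\{|u|\le1\}}\big)\nu(du).$$ Then $\mathbb E|\mathcal A_Xg(X)|<\infty$ and $\mathbb E[\mathcal A_X g(X)]=0$. (iv) (Type C) Suppose $\nu=0$ and $\sigma^2>0$, and put $$\mathcal A_X g(x)=(x-\beta) g(x)-\sigma^2 g'(x).$$ Then $\mathbb E|\mathcal A_Xg(X)|<\infty$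 and $\mathbb E[\mathcal A_X g(X)]=0$. No first-moment assumption is made in (i) and (ii). In (i) and (ii) one has $\mathbb E|\mathcal A_Xg(X)|<\infty$ for every $g\in\mathcal F_X$ as soon as $\sup_{x\in\mathbb R}|x|\,\nu\big([x-1,x+1]\setminus[-1,1]\big)<\infty$. (For instance, this condition holds for the Lévy measures of $\alpha$-stable laws with $0<\alpha<1$, and whenever $\int_{|u|>1}|u|\,\nu(du)<\infty$.) -/

import Mathlib

open MeasureTheory Filter Topology
open scoped ContDiff

noncomputable section

/-- The indicator of `{u : |u| ≤ 1}`. -/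
def smallJump (u : ℝ) : ℝ := if |u| ≤ 1 then 1 else 0

/-- `ν` is a Lévy measure on `ℝ`: `ν {0} = 0` and `∫ (1 ∧ u²) ν(du) < ∞`. -/
structure IsLevyMeasure (ν : Measure ℝ) : Prop where
  zero : ν {0} = 0
  lintegral_lt_top : ∫⁻ u, ENNReal.ofReal (min 1 (u ^ 2)) ∂ν < ⊤

/-- The Lévy–Khintchine exponent
`itβ - σ²t²/2 + ∫ (e^{itu} - 1 - itu 1_{|u| ≤ 1}) ν(du)`. -/
def levyExponent (β σ : ℝ) (ν : Measure ℝ) (t : ℝ) : ℂ :=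
  Complex.I * t * β - (σ : ℂ) ^ 2 * (t : ℂ) ^ 2 / 2
    + ∫ u : ℝ, (Complex.exp (Complex.I * t * u) - 1 - Complex.I * t * u * smallJump u) ∂ν

/-- `X ∼ IDD(β, σ², ν)`: `ν` is a Lévy measure and the characteristic function of the law of the
random variable `X` is given by the Lévy–Khintchine formula with triplet `(β, σ², ν)`. -/
structure IsIDD {Ω : Type*} [MeasurableSpace Ω] (P : Measure Ω) (X : Ω → ℝ)
    (β σ : ℝ) (ν : Measure ℝ) : Prop where
  aemeasurable : AEMeasurable X P
  levy : IsLevyMeasure ν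
  charFun_eq : ∀ t : ℝ, charFun (P.map X) t = Complex.exp (levyExponent β σ ν t)

/-- The function class `F_X`: bounded smooth functions `f` on `ℝ` such that
`sup_x |x^m f^{(n)}(x)| < ∞` for all `m, n`, and all derivatives vanish at `±∞`. -/
def steinClass : Set (ℝ → ℝ) :=
  {f | ContDiff ℝ ∞ f ∧ (∃ C : ℝ, ∀ x, |f x| ≤ C) ∧
    (∀ m n : ℕ, BddAbove (Set.range fun x : ℝ => |x ^ m * iteratedDeriv n f x|)) ∧
    ∀ k : ℕ, Tendsto (iteratedDeriv k f) atTop (𝓝 0) ∧ Tendsto (iteratedDeriv k f) atBot (𝓝 0)}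

/-- `β_ν = β - ∫_{|u| ≤ 1} u ν(du)`. -/
def levyDrift (β : ℝ) (ν : Measure ℝ) : ℝ := β - ∫ u in {u : ℝ | |u| ≤ 1}, u ∂ν

/-- `x g(x) - ∫ u g(x+u) ν(du)`. -/
def steinOpA (ν : Measure ℝ) (g : ℝ → ℝ) (x : ℝ) : ℝ :=
  x * g x - ∫ u, u * g (x + u) ∂ν

/-- `(x - β_ν) g(x) - ∫ u g(x+u) ν(du)`. -/
def steinOpB (β : ℝ) (ν : Measure ℝ) (g : ℝ → ℝ) (x : ℝ) : ℝ :=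
  (x - levyDrift β ν) * g x - ∫ u, u * g (x + u) ∂ν

/-- `(x - β) g(x) - ∫ u (g(x+u) - g(x) 1_{|u| ≤ 1}) ν(du)`. -/
def steinOpC (β : ℝ) (ν : Measure ℝ) (g : ℝ → ℝ) (x : ℝ) : ℝ :=
  (x - β) * g x - ∫ u, u * (g (x + u) - g x * smallJump u) ∂ν

/-- `(x - β) g(x) - σ² g'(x)`. -/
def steinOpGauss (β σ : ℝ) (g : ℝ → ℝ) (x : ℝ) : ℝ :=
  (x - β) * g x - σ ^ 2 * deriv g x

/-- `sup_x |x| ν([x-1, x+1] \ [-1, 1]) < ∞`. -/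
def LocallyLightTails (ν : Measure ℝ) : Prop :=
  ∃ C : ℝ, ∀ x : ℝ, |x| * ν.real (Set.Icc (x - 1) (x + 1) \ Set.Icc (-1) 1) ≤ C

end

/-! ### Lévy measures -/

/-! Suppose first that `ν` integrates `|u|` over the large jumps. Then the exponent `ψ` is
differentiable, with `ψ'(t) = iβ - σ²t + i ∫ u (e^{itu} - 1_{|u| ≤ 1}) ν(du)`, and the
characteristic function `φ` solves `φ' = ψ' φ`. Functions of the class are Schwartz, so `g(x) = ∫
e^{itx} f(t) dt` with `f` Schwartz. By Fubini `E[X g(X)] = ∫ i f' φ`, which by parts is `-∫ i f ψ'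
φ`; the three terms of `ψ'` transform back to `β E g(X)`, `σ² E g'(X)` and the expected jump part.
This is `stein_identity`, which settles both type C cases.

In types A and B the function `φ` need not be differentiable. Let `ρ_r` be the law with the same
drift and Lévy measure restricted to `|u| ≤ r`. The full law `μ` is `ρ_r` convolved with a compound
Poisson law, whose atom at `0` has mass at least `c_r = exp(-ν{|u| > r})`. Hence `κ_r = c_r ρ_r ≤ μ`
with mass tending to `1` (`exists_truncated_law`), and `∫ A g dκ_r → ∫ A g dμ` as soon as `A g` is
`μ`-integrable.

It remains to make `∫ A g dκ_r` small. With `h(x) = ∫ u g(x+u) ν(du)` and `h_r` its restriction to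
`|u| ≤ r`, the identity for `ρ_r` turns this integral into `∫ (h_r - h) dκ_r`. Since `h_r - h` has
no evident integrable majorant, `h_r` is compared instead with `h 1_{|x| ≤ r}`; the rest, `h 1_{|x|
> r}`, tends to `0` in `L¹(μ)`. The comparison error lives where `r` separates `|x|` from `|u|`. At
most `|x+u| + 1` integers `r` do so, and `g(x+u)` decays rapidly in `|x+u|`. Therefore `∑
error(r)/r` is finite, and divergence of the harmonic series makes the error small for infinitely
many `r`, which is enough. -/

lemma measurable_smallJump : Measurable smallJump :=
  Measurable.ite (measurableSet_le measurable_norm measurable_const) measurable_const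
    measurable_const

lemma abs_smallJump_le_one (u : ℝ) : |smallJump u| ≤ 1 := by
  unfold smallJump; split_ifs <;> simp

lemma measurableSet_abs_le (r : ℝ) : MeasurableSet {u : ℝ | |u| ≤ r} :=
  measurableSet_le measurable_norm measurable_const

lemma measurableSet_lt_abs (r : ℝ) : MeasurableSet {u : ℝ | r < |u|} :=
  measurableSet_lt measurable_const measurable_norm

lemma compl_abs_le (r : ℝ) : {u : ℝ | |u| ≤ r}ᶜ = {u : ℝ | r < |u|} := by
  ext u; simp

namespace IsLevyMeasure

variable {ν : Measure ℝ}

lemma integrable_min (h : IsLevyMeasure ν) : Integrable (fun u : ℝ => min 1 (u ^ 2)) ν := by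
  refine ⟨by fun_prop, ?_⟩
  rw [hasFiniteIntegral_iff_ofReal (ae_of_all _ fun u => by positivity)]
  exact h.lintegral_lt_top

lemma restrict (h : IsLevyMeasure ν) (s : Set ℝ) : IsLevyMeasure (ν.restrict s) :=
  ⟨nonpos_iff_eq_zero.1 ((Measure.restrict_apply_le s {0}).trans h.zero.le),
    (lintegral_mono' Measure.restrict_le_self le_rfl).trans_lt h.lintegral_lt_top⟩

lemma measure_lt_abs_lt_top (h : IsLevyMeasure ν) {r : ℝ} (hr : 0 < r) :
    ν {u : ℝ | r < |u|} < ⊤ := by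
  have h1 := h.integrable_min.measure_ge_lt_top (ε := min 1 (r ^ 2)) (by positivity)
  refine (measure_mono fun u hu => ?_).trans_lt h1
  have : r ^ 2 ≤ u ^ 2 := by
    rw [← sq_abs u]; exact pow_le_pow_left₀ hr.le (le_of_lt hu) 2
  exact min_le_min le_rfl this

/-- Weighting by `1 ∧ u²` gives a finite measure, and the weight vanishes only at the null point
`0`, so it can be divided out. Needed for Fubini. -/
lemma sigmaFinite (h : IsLevyMeasure ν) : SigmaFinite ν := by
  have hm : Measurable fun u : ℝ => ENNReal.ofReal (min 1 (u ^ 2)) := by fun_prop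
  have : IsFiniteMeasure (ν.withDensity fun u => ENNReal.ofReal (min 1 (u ^ 2))) :=
    isFiniteMeasure_withDensity h.lintegral_lt_top.ne
  have hne : ∀ᵐ u ∂ν, ENNReal.ofReal (min 1 (u ^ 2)) ≠ 0 := by
    have : ∀ᵐ u ∂ν, u ≠ 0 := by
      rw [ae_iff]; simpa using h.zero
    filter_upwards [this] with u hu
    have : 0 < min 1 (u ^ 2) := by positivity
    exact (ENNReal.ofReal_pos.2 this).ne'
  rw [← withDensity_inv_same hm hne (ae_of_all _ fun _ => ENNReal.ofReal_ne_top)]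
  refine SigmaFinite.withDensity_of_ne_top ?_
  refine withDensity_absolutelyContinuous _ _ ?_
  filter_upwards [hne] with u hu
  simpa using hu

end IsLevyMeasure

/-- A weight dominating `|u| ‖e^{itu} - 1_{|u| ≤ 1}‖` up to the factor `1 + |t|`. -/
noncomputable def jumpWeight (u : ℝ) : ℝ :=
  min 1 (u ^ 2) + {u : ℝ | 1 < |u|}.indicator (fun u => |u|) u

lemma jumpWeight_of_le {u : ℝ} (hu : |u| ≤ 1) : jumpWeight u = u ^ 2 := by
  have : u ^ 2 ≤ 1 := by rw [← sq_abs]; exact pow_le_one₀ (abs_nonneg u) hu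
  simp [jumpWeight, not_lt.2 hu, this]

lemma jumpWeight_of_lt {u : ℝ} (hu : 1 < |u|) : jumpWeight u = 1 + |u| := by
  have : 1 ≤ u ^ 2 := by rw [← sq_abs]; exact one_le_pow₀ hu.le
  simp [jumpWeight, hu, this]

lemma jumpWeight_nonneg (u : ℝ) : 0 ≤ jumpWeight u :=
  add_nonneg (by positivity) (Set.indicator_nonneg (fun _ _ => abs_nonneg _) _)

lemma IsLevyMeasure.integrable_jumpWeight {ν : Measure ℝ} (h : IsLevyMeasure ν)
    (hbig : IntegrableOn (fun u : ℝ => u) {u | 1 < |u|} ν) : Integrable jumpWeight ν :=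
  h.integrable_min.add ((integrable_indicator_iff (measurableSet_lt_abs 1)).2 hbig.abs)

lemma norm_exp_I_mul (r : ℝ) : ‖Complex.exp (Complex.I * r)‖ = 1 := by
  rw [mul_comm]; exact Complex.norm_exp_ofReal_mul_I r

/-- The growth in `t` is only linear, so a Schwartz factor in `t` absorbs it; the same product bound
serves differentiation under the integral and Fubini. -/
lemma norm_jump_exp_sub_smallJump_le (t u : ℝ) :
    ‖(u : ℂ) * (Complex.exp (Complex.I * (t * u : ℝ)) - smallJump u)‖
      ≤ (1 + |t|) * jumpWeight u := by
  rw [norm_mul, Complex.norm_real, Real.norm_eq_abs]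
  rcases le_or_gt |u| 1 with hu | hu
  · have h1 : smallJump u = 1 := if_pos hu
    have h2 := Real.norm_exp_I_mul_ofReal_sub_one_le (x := t * u)
    rw [Real.norm_eq_abs, abs_mul] at h2
    rw [jumpWeight_of_le hu, h1, Complex.ofReal_one]
    calc |u| * _ ≤ |u| * (|t| * |u|) := by gcongr
      _ = |t| * u ^ 2 := by rw [← sq_abs u]; ring
      _ ≤ _ := by nlinarith [sq_nonneg u]
  · have h1 : smallJump u = 0 := if_neg (not_le.2 hu)
    rw [jumpWeight_of_lt hu, h1, Complex.ofReal_zero, sub_zero, norm_exp_I_mul]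
    nlinarith [abs_nonneg u, abs_nonneg t]

lemma norm_levy_integrand_le (t u : ℝ) :
    ‖Complex.exp (Complex.I * t * u) - 1 - Complex.I * t * u * smallJump u‖
      ≤ (2 + 3 * t ^ 2) * min 1 (u ^ 2) := by
  have e : (Complex.I * t * u : ℂ) = Complex.I * (t * u : ℝ) := by push_cast; ring
  rw [e]
  rcases le_or_gt |u| 1 with hu | hu
  · have h1 : smallJump u = 1 := if_pos hu
    have h2 : min 1 (u ^ 2) = u ^ 2 := by
      rw [min_eq_right]; rw [← sq_abs]; exact pow_le_one₀ (abs_nonneg u) hu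
    rw [h1, h2, Complex.ofReal_one, mul_one]
    have hn : ‖Complex.I * (t * u : ℝ)‖ = |t * u| := by simp
    rcases le_or_gt |t * u| 1 with h | h
    · have := Complex.norm_exp_sub_one_sub_id_le (x := Complex.I * (t * u : ℝ)) (by rw [hn]; exact h)
      rw [hn, sq_abs] at this
      nlinarith [sq_nonneg (t * u), sq_nonneg u]
    -- For `|tu| > 1` the first-order bound suffices, because then `|tu| ≤ (tu)²`.
    · have h3 := Real.norm_exp_I_mul_ofReal_sub_one_le (x := t * u)
      rw [Real.norm_eq_abs] at h3
      have := norm_sub_le (Complex.exp (Complex.I * (t * u : ℝ)) - 1) (Complex.I * (t * u : ℝ))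
      rw [hn] at this
      have h4 : |t * u| ≤ (t * u) ^ 2 := by rw [← sq_abs (t * u)]; nlinarith
      nlinarith [sq_nonneg (t * u), sq_nonneg u]
  · have h1 : smallJump u = 0 := if_neg (not_le.2 hu)
    have h2 : min 1 (u ^ 2) = 1 := by
      rw [min_eq_left]; rw [← sq_abs]; exact one_le_pow₀ hu.le
    rw [h1, h2, Complex.ofReal_zero, mul_zero, sub_zero]
    have := norm_sub_le (Complex.exp (Complex.I * (t * u : ℝ))) 1
    rw [norm_exp_I_mul, norm_one] at this
    nlinarith [sq_nonneg t]

lemma measurable_levy_integrand (t : ℝ) : Measurable fun u : ℝ =>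
    Complex.exp (Complex.I * t * u) - 1 - Complex.I * t * u * smallJump u := by
  have := measurable_smallJump
  fun_prop

lemma IsLevyMeasure.integrable_levy_integrand {ν : Measure ℝ} (h : IsLevyMeasure ν) (t : ℝ) :
    Integrable (fun u : ℝ =>
      Complex.exp (Complex.I * t * u) - 1 - Complex.I * t * u * smallJump u) ν :=
  (h.integrable_min.const_mul (2 + 3 * t ^ 2)).mono' (measurable_levy_integrand t).aestronglyMeasurable
    (ae_of_all _ (norm_levy_integrand_le t))

/-- `∫ u (e^{itu} - 1_{|u| ≤ 1}) ν(du)`. -/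
noncomputable def jumpSymbol (ν : Measure ℝ) (t : ℝ) : ℂ :=
  ∫ u : ℝ, (u : ℂ) * (Complex.exp (Complex.I * (t * u : ℝ)) - smallJump u) ∂ν

lemma measurable_jump_exp_sub_smallJump : Measurable fun p : ℝ × ℝ =>
    (p.2 : ℂ) * (Complex.exp (Complex.I * (p.1 * p.2 : ℝ)) - smallJump p.2) := by
  have := measurable_smallJump
  fun_prop

lemma norm_jumpSymbol_le {ν : Measure ℝ} (h : Integrable jumpWeight ν) (t : ℝ) :
    ‖jumpSymbol ν t‖ ≤ (1 + |t|) * ∫ u, jumpWeight u ∂ν := by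
  rw [← integral_const_mul]
  exact norm_integral_le_of_norm_le (h.const_mul _)
    (ae_of_all _ (norm_jump_exp_sub_smallJump_le t))

lemma stronglyMeasurable_jumpSymbol (ν : Measure ℝ) [SFinite ν] :
    StronglyMeasurable (jumpSymbol ν) :=
  measurable_jump_exp_sub_smallJump.stronglyMeasurable.integral_prod_right

lemma IsLevyMeasure.hasDerivAt_levyExponent {ν : Measure ℝ} (h : IsLevyMeasure ν)
    (hw : Integrable jumpWeight ν) (β σ t : ℝ) :
    HasDerivAt (levyExponent β σ ν)
      (Complex.I * β - (σ : ℂ) ^ 2 * t + Complex.I * jumpSymbol ν t) t := by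
  have h1 : HasDerivAt (fun t : ℝ => ∫ u : ℝ,
      (Complex.exp (Complex.I * t * u) - 1 - Complex.I * t * u * smallJump u) ∂ν)
      (Complex.I * jumpSymbol ν t) t := by
    rw [jumpSymbol, ← integral_const_mul]
    refine (hasDerivAt_integral_of_dominated_loc_of_deriv_le (s := Metric.ball t 1)
      (bound := fun u => (2 + |t|) * jumpWeight u) (Metric.ball_mem_nhds t one_pos)
      (Eventually.of_forall fun s => (measurable_levy_integrand s).aestronglyMeasurable)
      (h.integrable_levy_integrand t)
      (F' := fun s u => Complex.I *
        ((u : ℂ) * (Complex.exp (Complex.I * (s * u : ℝ)) - smallJump u))) ?_ ?_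
      (hw.const_mul _) ?_).2
    · have := measurable_smallJump
      exact Measurable.aestronglyMeasurable (by fun_prop)
    · refine ae_of_all _ fun u s hs => ?_
      rw [norm_mul, Complex.norm_I, one_mul]
      refine (norm_jump_exp_sub_smallJump_le s u).trans ?_
      have : |s| ≤ 1 + |t| := by
        have := abs_sub_abs_le_abs_sub s t
        rw [Metric.mem_ball, Real.dist_eq] at hs
        linarith
      exact mul_le_mul_of_nonneg_right (by linarith) (jumpWeight_nonneg u)
    · refine ae_of_all _ fun u s _ => ?_
      have h2 : HasDerivAt (fun s : ℝ => Complex.I * s * u) (Complex.I * u) s := by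
        simpa using (((hasDerivAt_id s).ofReal_comp.const_mul Complex.I).mul_const (u : ℂ))
      have h3 := (h2.cexp.sub_const 1).sub (h2.mul_const (smallJump u : ℂ))
      refine h3.congr_deriv ?_
      push_cast
      rw [mul_assoc Complex.I (s : ℂ) (u : ℂ)]
      ring
  have h2 : HasDerivAt (fun t : ℝ => Complex.I * (t : ℂ) * β) (Complex.I * β) t := by
    simpa using (((hasDerivAt_id t).ofReal_comp.const_mul Complex.I).mul_const (β : ℂ))
  have h3 : HasDerivAt (fun t : ℝ => (σ : ℂ) ^ 2 * (t : ℂ) ^ 2 / 2) ((σ : ℂ) ^ 2 * t) t := by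
    have := (((hasDerivAt_id t).ofReal_comp.pow 2).const_mul ((σ : ℂ) ^ 2)).div_const 2
    refine this.congr_deriv ?_
    push_cast
    simp only [id]
    ring
  exact (h2.sub h3).add h1

/-! ### Fourier representation of the function class -/

open scoped SchwartzMap FourierTransform in
lemma exists_schwartzMap_of_mem_steinClass {g : ℝ → ℝ} (hg : g ∈ steinClass) :
    ∃ F : 𝓢(ℝ, ℂ), ∀ x, F x = (g x : ℂ) := by
  refine ⟨⟨fun x => (g x : ℂ), Complex.ofRealCLM.contDiff.comp hg.1, fun k n => ?_⟩, fun x => rfl⟩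
  obtain ⟨C, hC⟩ := hg.2.2.1 k n
  refine ⟨C, fun x => ?_⟩
  have h1 : ‖iteratedFDeriv ℝ n (fun x => (g x : ℂ)) x‖ = ‖iteratedFDeriv ℝ n g x‖ :=
    Complex.ofRealLI.norm_iteratedFDeriv_comp_left (f := g) hg.1.contDiffAt
      (mod_cast le_top)
  rw [h1, norm_iteratedFDeriv_eq_norm_iteratedDeriv, ← norm_pow, ← norm_mul]
  exact hC ⟨x, rfl⟩

open scoped SchwartzMap FourierTransform in
-- Fourier inversion without `2π` in the exponent: `f` is the Fourier transform of the dilate `y ↦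
-- F(2πy)`, inverted at `x / 2π`.
lemma SchwartzMap.exists_eq_integral_exp (F : 𝓢(ℝ, ℂ)) :
    ∃ f : 𝓢(ℝ, ℂ), ∀ x, F x = ∫ t : ℝ, Complex.exp (Complex.I * (t * x : ℝ)) * f t := by
  have h2π : (2 * Real.pi) ≠ 0 := by positivity
  let e : ℝ ≃L[ℝ] ℝ := ContinuousLinearEquiv.unitsEquivAut ℝ (Units.mk0 (2 * Real.pi) h2π)
  let G : 𝓢(ℝ, ℂ) := SchwartzMap.compCLMOfContinuousLinearEquiv ℝ e F
  refine ⟨𝓕 G, fun x => ?_⟩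
  have h1 : F x = G (x / (2 * Real.pi)) := by
    change F x = F (x / (2 * Real.pi) * (2 * Real.pi))
    rw [div_mul_cancel₀ _ h2π]
  have h2 : 𝓕⁻ (𝓕 G) = G := FourierTransform.fourierInv_fourier_eq G
  rw [h1]
  conv_lhs => rw [← h2]
  rw [SchwartzMap.fourierInv_coe, Real.fourierInv_eq']
  refine integral_congr_ae (ae_of_all _ fun t => ?_)
  simp only [smul_eq_mul]
  congr 2
  rw [mul_comm Complex.I]
  congr 2
  simp only [RCLike.inner_apply, conj_trivial]
  field_simp

open scoped SchwartzMap in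
lemma SchwartzMap.deriv_eq_integral_exp {F f : 𝓢(ℝ, ℂ)}
    (h : ∀ x, F x = ∫ t : ℝ, Complex.exp (Complex.I * (t * x : ℝ)) * f t) (x : ℝ) :
    deriv F x = ∫ t : ℝ, Complex.exp (Complex.I * (t * x : ℝ)) * (Complex.I * t * f t) := by
  have hF : (F : ℝ → ℂ) = fun x => ∫ t : ℝ, Complex.exp (Complex.I * (t * x : ℝ)) * f t :=
    funext h
  have hc := f.continuous
  rw [hF]
  refine (hasDerivAt_integral_of_dominated_loc_of_deriv_le (s := Set.univ)
    (bound := fun t => ‖t‖ ^ 1 * ‖f t‖) univ_mem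
    (Eventually.of_forall fun s => Continuous.aestronglyMeasurable (by fun_prop)) ?_
    (F' := fun s t => Complex.exp (Complex.I * (t * s : ℝ)) * (Complex.I * t * f t))
    (Continuous.aestronglyMeasurable (by fun_prop))
    (ae_of_all _ fun t s _ => ?_) (f.integrable_pow_mul volume 1)
    (ae_of_all _ fun t s _ => ?_)).2.deriv
  · refine f.integrable.mono (Continuous.aestronglyMeasurable (by fun_prop))
      (ae_of_all _ fun t => ?_)
    rw [norm_mul, norm_exp_I_mul, one_mul]
  · rw [norm_mul, norm_exp_I_mul, one_mul, norm_mul, norm_mul, Complex.norm_I, one_mul,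
      Complex.norm_real, pow_one]
  · have h2 : HasDerivAt (fun s : ℝ => Complex.I * ((t * s : ℝ) : ℂ)) (Complex.I * t) s := by
      simpa using (((hasDerivAt_id s).const_mul t).ofReal_comp.const_mul Complex.I)
    refine (h2.cexp.mul_const (f t)).congr_deriv ?_
    ring

/-- Integrating the Fourier representation against a probability measure produces its
characteristic function. -/
lemma integral_integral_exp_mul (μ : Measure ℝ) [IsFiniteMeasure μ] {F : ℝ → ℂ}
    (hF : Integrable F) :
    ∫ x, (∫ t : ℝ, Complex.exp (Complex.I * (t * x : ℝ)) * F t) ∂μ = ∫ t, F t * charFun μ t := by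
  have hi : Integrable (Function.uncurry fun (x t : ℝ) =>
      Complex.exp (Complex.I * (t * x : ℝ)) * F t) (μ.prod volume) := by
    have h1 : Integrable (fun p : ℝ × ℝ => (1 : ℂ) * F p.2) (μ.prod volume) :=
      (integrable_const (1 : ℂ)).mul_prod hF
    refine h1.mono ?_ (ae_of_all _ fun p => ?_)
    · have h3 : AEStronglyMeasurable (fun p : ℝ × ℝ => F p.2) (μ.prod volume) :=
        hF.aestronglyMeasurable.comp_snd
      exact (Continuous.aestronglyMeasurable (by fun_prop)).mul h3
    · simp only [Function.uncurry, norm_mul, norm_exp_I_mul, norm_one, le_refl]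
  rw [integral_integral_swap hi]
  refine integral_congr_ae (ae_of_all _ fun t => ?_)
  simp only
  rw [integral_mul_const, charFun_apply_real, mul_comm]
  congr 1
  refine integral_congr_ae (ae_of_all _ fun x => ?_)
  simp only
  congr 1
  push_cast
  ring

lemma integrable_exp_mul {F : ℝ → ℂ} (hF : Integrable F) (x : ℝ) :
    Integrable fun t : ℝ => Complex.exp (Complex.I * (t * x : ℝ)) * F t := by
  refine hF.mono ((Continuous.aestronglyMeasurable (by fun_prop)).mul hF.aestronglyMeasurable)
    (ae_of_all _ fun t => ?_)
  rw [norm_mul, norm_exp_I_mul, one_mul]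

open scoped SchwartzMap in
lemma SchwartzMap.mul_eq_integral_exp {F f : 𝓢(ℝ, ℂ)}
    (h : ∀ x, F x = ∫ t : ℝ, Complex.exp (Complex.I * (t * x : ℝ)) * f t) (x : ℝ) :
    x * F x = ∫ t : ℝ, Complex.exp (Complex.I * (t * x : ℝ)) * (Complex.I * deriv f t) := by
  have hd : Integrable (deriv f) := (SchwartzMap.derivCLM ℝ ℂ f).integrable
  have hu : ∀ t : ℝ, HasDerivAt (fun t : ℝ => Complex.exp (Complex.I * (t * x : ℝ)))
      (Complex.exp (Complex.I * (t * x : ℝ)) * (Complex.I * x)) t := fun t => by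
    have h2 : HasDerivAt (fun s : ℝ => Complex.I * ((s * x : ℝ) : ℂ)) (Complex.I * x) t := by
      simpa using (((hasDerivAt_id t).mul_const x).ofReal_comp.const_mul Complex.I)
    exact h2.cexp
  have key := integral_mul_deriv_eq_deriv_mul_of_integrable (fun t _ => hu t)
    (fun t _ => f.differentiableAt.hasDerivAt) (integrable_exp_mul hd x)
    (((integrable_exp_mul f.integrable x).const_mul (Complex.I * x)).congr
      (ae_of_all _ fun t => by simp only [Pi.mul_apply]; ring)) (integrable_exp_mul f.integrable x)
  have e1 : ∫ t : ℝ, Complex.exp (Complex.I * (t * x : ℝ)) * (Complex.I * deriv f t)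
      = Complex.I * ∫ t : ℝ, Complex.exp (Complex.I * (t * x : ℝ)) * deriv f t := by
    rw [← integral_const_mul]
    exact integral_congr_ae (ae_of_all _ fun t => by simp only; ring)
  have e2 : ∫ t : ℝ, Complex.exp (Complex.I * (t * x : ℝ)) * (Complex.I * x) * f t
      = Complex.I * x * F x := by
    rw [h x, ← integral_const_mul]
    exact integral_congr_ae (ae_of_all _ fun t => by simp only; ring)
  rw [e1, key, e2]
  linear_combination ((x : ℂ) * F x) * Complex.I_mul_I

/-! ### The jump part of the Stein operator -/

lemma exists_deriv_bound {g : ℝ → ℝ} (hg : g ∈ steinClass) (m n : ℕ) :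
    ∃ C : ℝ, 0 ≤ C ∧ ∀ x, |x| ^ m * |iteratedDeriv n g x| ≤ C := by
  obtain ⟨C, hC⟩ := hg.2.2.1 m n
  have h : ∀ x, |x| ^ m * |iteratedDeriv n g x| ≤ C := fun x => by
    rw [← abs_pow, ← abs_mul]; exact hC ⟨x, rfl⟩
  exact ⟨C, le_trans (by positivity) (h 0), h⟩

lemma steinClass_differentiable {g : ℝ → ℝ} (hg : g ∈ steinClass) : Differentiable ℝ g :=
  hg.1.differentiable (by simp)

/-- Small jumps use the Lipschitz constant of `g`, large jumps its sup norm; uniformity in `x` makes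
the jump part bounded. -/
lemma exists_jump_increment_bound {g : ℝ → ℝ} (hg : g ∈ steinClass) :
    ∃ C : ℝ, 0 ≤ C ∧ ∀ x u, |u * (g (x + u) - g x * smallJump u)| ≤ C * jumpWeight u := by
  obtain ⟨C0, h00, hC0⟩ := exists_deriv_bound hg 0 0
  obtain ⟨C1, h01, hC1⟩ := exists_deriv_bound hg 0 1
  simp only [pow_zero, one_mul, iteratedDeriv_zero, iteratedDeriv_one] at hC0 hC1
  refine ⟨C0 + C1, by positivity, fun x u => ?_⟩
  rw [abs_mul]
  rcases le_or_gt |u| 1 with hu | hu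
  · have h1 : smallJump u = 1 := if_pos hu
    have h2 : |g (x + u) - g x| ≤ C1 * |u| := by
      have := Convex.norm_image_sub_le_of_norm_deriv_le (𝕜 := ℝ) (f := g) (s := Set.univ) (C := C1)
        (fun y _ => steinClass_differentiable hg y) (fun y _ => hC1 y) convex_univ
        (Set.mem_univ x) (Set.mem_univ (x + u))
      simpa using this
    rw [h1, mul_one, jumpWeight_of_le hu]
    calc |u| * |g (x + u) - g x| ≤ |u| * (C1 * |u|) := by gcongr
      _ = C1 * u ^ 2 := by rw [← sq_abs u]; ring
      _ ≤ _ := by nlinarith [sq_nonneg u]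
  · have h1 : smallJump u = 0 := if_neg (not_le.2 hu)
    rw [h1, mul_zero, sub_zero, jumpWeight_of_lt hu]
    nlinarith [hC0 (x + u), abs_nonneg u]

lemma measurable_jump_increment {g : ℝ → ℝ} (hg : g ∈ steinClass) :
    Measurable fun p : ℝ × ℝ => p.2 * (g (p.1 + p.2) - g p.1 * smallJump p.2) := by
  have := measurable_smallJump
  have := hg.1.continuous.measurable
  fun_prop

/-- `∫ u (g(x+u) - g(x) 1_{|u| ≤ 1}) ν(du)`. -/
noncomputable def jumpPart (ν : Measure ℝ) (g : ℝ → ℝ) (x : ℝ) : ℝ :=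
  ∫ u, u * (g (x + u) - g x * smallJump u) ∂ν

lemma integrable_jump_increment {ν : Measure ℝ} (hw : Integrable jumpWeight ν) {g : ℝ → ℝ}
    (hg : g ∈ steinClass) (x : ℝ) :
    Integrable (fun u => u * (g (x + u) - g x * smallJump u)) ν := by
  obtain ⟨C, -, hC⟩ := exists_jump_increment_bound hg
  exact (hw.const_mul C).mono'
    ((measurable_jump_increment hg).comp measurable_prodMk_left).aestronglyMeasurable
    (ae_of_all _ (hC x))

lemma integrable_jumpPart {ν : Measure ℝ} [SFinite ν] (hw : Integrable jumpWeight ν) {g : ℝ → ℝ}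
    (hg : g ∈ steinClass) (μ : Measure ℝ) [IsFiniteMeasure μ] :
    Integrable (jumpPart ν g) μ := by
  obtain ⟨C, -, hC⟩ := exists_jump_increment_bound hg
  refine Integrable.of_bound (C := C * ∫ u, jumpWeight u ∂ν)
    (measurable_jump_increment hg).stronglyMeasurable.integral_prod_right.aestronglyMeasurable
    (ae_of_all _ fun x => ?_)
  rw [← integral_const_mul]
  exact norm_integral_le_of_norm_le (hw.const_mul C) (ae_of_all _ (hC x))

lemma integrable_of_abs_le_const {f : ℝ → ℝ} (hf : Continuous f) {C : ℝ} (hC : ∀ x, |f x| ≤ C)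
    (μ : Measure ℝ) [IsFiniteMeasure μ] : Integrable f μ :=
  Integrable.of_bound hf.aestronglyMeasurable C (ae_of_all _ hC)

lemma integrable_sub_mul {g : ℝ → ℝ} (hg : g ∈ steinClass) (β : ℝ) (μ : Measure ℝ)
    [IsFiniteMeasure μ] : Integrable (fun x => (x - β) * g x) μ := by
  obtain ⟨C0, h00, hC0⟩ := exists_deriv_bound hg 0 0
  obtain ⟨C1, h01, hC1⟩ := exists_deriv_bound hg 1 0
  simp only [pow_zero, one_mul, pow_one, iteratedDeriv_zero] at hC0 hC1
  have hc := hg.1.continuous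
  refine integrable_of_abs_le_const (C := C1 + |β| * C0) (by fun_prop) (fun x => ?_) μ
  rw [abs_mul]
  calc |x - β| * |g x| ≤ (|x| + |β|) * |g x| := by gcongr; exact abs_sub _ _
    _ = |x| * |g x| + |β| * |g x| := by ring
    _ ≤ _ := by gcongr; exacts [hC1 x, hC0 x]

lemma integrable_deriv_steinClass {g : ℝ → ℝ} (hg : g ∈ steinClass) (μ : Measure ℝ)
    [IsFiniteMeasure μ] : Integrable (deriv g) μ := by
  obtain ⟨C1, h01, hC1⟩ := exists_deriv_bound hg 0 1
  simp only [pow_zero, one_mul, iteratedDeriv_one] at hC1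
  exact integrable_of_abs_le_const (hg.1.continuous_deriv (by simp)) hC1 μ

open scoped SchwartzMap in
lemma integrable_one_add_abs_mul_norm (f : 𝓢(ℝ, ℂ)) :
    Integrable fun t : ℝ => (1 + |t|) * ‖f t‖ := by
  have h1 := f.integrable_pow_mul volume 1
  have h0 := f.integrable_pow_mul volume 0
  refine (h0.add h1).congr (ae_of_all _ fun t => ?_)
  simp only [Pi.add_apply, pow_zero, pow_one, Real.norm_eq_abs]
  ring

open scoped SchwartzMap in
lemma integrable_mul_jumpSymbol {ν : Measure ℝ} [SFinite ν] (hw : Integrable jumpWeight ν)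
    (f : 𝓢(ℝ, ℂ)) : Integrable fun t => f t * jumpSymbol ν t := by
  refine ((integrable_one_add_abs_mul_norm f).mul_const (∫ u, jumpWeight u ∂ν)).mono'
    (f.continuous.aestronglyMeasurable.mul (stronglyMeasurable_jumpSymbol ν).aestronglyMeasurable)
    (ae_of_all _ fun t => ?_)
  rw [norm_mul]
  nlinarith [norm_jumpSymbol_le hw t, norm_nonneg (f t)]

open scoped SchwartzMap in
-- Translation by `u` multiplies the frequency `t` component by `e^{itu}`, so the jump part is the
-- Fourier multiplier with symbol `jumpSymbol`.
lemma jumpPart_eq_integral_exp {ν : Measure ℝ} [SFinite ν] (hw : Integrable jumpWeight ν)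
    {g : ℝ → ℝ} {f : 𝓢(ℝ, ℂ)}
    (h : ∀ x, (g x : ℂ) = ∫ t : ℝ, Complex.exp (Complex.I * (t * x : ℝ)) * f t) (x : ℝ) :
    (jumpPart ν g x : ℂ)
      = ∫ t : ℝ, Complex.exp (Complex.I * (t * x : ℝ)) * (f t * jumpSymbol ν t) := by
  have hi : Integrable (Function.uncurry fun (u t : ℝ) =>
      Complex.exp (Complex.I * (t * x : ℝ)) * (f t *
        ((u : ℂ) * (Complex.exp (Complex.I * (t * u : ℝ)) - smallJump u)))) (ν.prod volume) := by
    refine (hw.mul_prod (integrable_one_add_abs_mul_norm f)).mono' ?_ (ae_of_all _ fun p => ?_)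
    · have h1 := f.continuous.measurable
      have h2 := measurable_smallJump
      exact Measurable.aestronglyMeasurable (by unfold Function.uncurry; fun_prop)
    · simp only [Function.uncurry]
      rw [norm_mul, norm_exp_I_mul, one_mul, norm_mul]
      nlinarith [norm_jump_exp_sub_smallJump_le p.2 p.1, norm_nonneg (f p.2)]
  rw [jumpPart, ← integral_complex_ofReal]
  calc ∫ u : ℝ, ((u * (g (x + u) - g x * smallJump u) : ℝ) : ℂ) ∂ν
      = ∫ u : ℝ, (∫ t : ℝ, Complex.exp (Complex.I * (t * x : ℝ)) * (f t *
        ((u : ℂ) * (Complex.exp (Complex.I * (t * u : ℝ)) - smallJump u)))) ∂ν := by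
        refine integral_congr_ae (ae_of_all _ fun u => ?_)
        simp only
        push_cast
        rw [h, h, ← integral_mul_const, ← integral_sub (integrable_exp_mul f.integrable _)
          ((integrable_exp_mul f.integrable _).mul_const _), ← integral_const_mul]
        refine integral_congr_ae (ae_of_all _ fun t => ?_)
        simp only
        push_cast
        rw [show Complex.I * (t * (x + u)) = Complex.I * (t * x) + Complex.I * (t * u) by ring,
          Complex.exp_add]
        ring
    _ = _ := by
        rw [integral_integral_swap hi]
        refine integral_congr_ae (ae_of_all _ fun t => ?_)
        simp only
        rw [integral_const_mul, integral_const_mul, jumpSymbol]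

/-- The Stein identity for an infinitely divisible law whose Lévy measure has integrable large
jumps. -/
theorem stein_identity {μ ν : Measure ℝ} [IsProbabilityMeasure μ] {β σ : ℝ}
    (hν : IsLevyMeasure ν) (hw : Integrable jumpWeight ν)
    (hφ : ∀ t : ℝ, charFun μ t = Complex.exp (levyExponent β σ ν t))
    {g : ℝ → ℝ} (hg : g ∈ steinClass) :
    ∫ x, (x - β) * g x ∂μ = σ ^ 2 * ∫ x, deriv g x ∂μ + ∫ x, jumpPart ν g x ∂μ := by
  have := hν.sigmaFinite
  obtain ⟨F, hF⟩ := exists_schwartzMap_of_mem_steinClass hg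
  obtain ⟨f, hf⟩ := F.exists_eq_integral_exp
  have hgf : ∀ x, (g x : ℂ) = ∫ t : ℝ, Complex.exp (Complex.I * (t * x : ℝ)) * f t :=
    fun x => (hF x).symm.trans (hf x)
  have hdF : ∀ x, ((deriv g x : ℝ) : ℂ) = deriv F x := fun x => by
    have h1 : (F : ℝ → ℂ) = fun x => (g x : ℂ) := funext hF
    rw [h1]
    exact ((steinClass_differentiable hg x).hasDerivAt.ofReal_comp.deriv).symm
  have hd : Integrable (deriv f) := (SchwartzMap.derivCLM ℝ ℂ f).integrable
  have htf : Integrable fun t : ℝ => Complex.I * t * f t := by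
    refine (f.integrable_pow_mul volume 1).mono'
      (Continuous.aestronglyMeasurable (by have := f.continuous; fun_prop))
      (ae_of_all _ fun t => ?_)
    simp
  have hφd : ∀ t : ℝ, HasDerivAt (charFun μ)
      ((Complex.I * β - (σ : ℂ) ^ 2 * t + Complex.I * jumpSymbol ν t) * charFun μ t) t :=
    fun t => by
      have h1 : charFun μ = fun t => Complex.exp (levyExponent β σ ν t) := funext hφ
      have h2 := (hν.hasDerivAt_levyExponent hw β σ t).cexp
      rw [h1]
      exact h2.congr_deriv (mul_comm _ _)
  have hφc : Continuous (charFun μ) := continuous_iff_continuousAt.2 fun t => (hφd t).continuousAt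
  have mulφ : ∀ {G : ℝ → ℂ}, Integrable G → Integrable fun t => G t * charFun μ t := fun {G} hG =>
    hG.mono (hG.aestronglyMeasurable.mul hφc.aestronglyMeasurable) (ae_of_all _ fun t => by
      rw [norm_mul]
      exact mul_le_of_le_one_right (norm_nonneg _) (norm_charFun_le_one t))
  have hfs := integrable_mul_jumpSymbol hw f
  have i1 : ∫ x, ((x * g x : ℝ) : ℂ) ∂μ = ∫ t, Complex.I * deriv f t * charFun μ t := by
    rw [← integral_integral_exp_mul μ (hd.const_mul Complex.I)]
    refine integral_congr_ae (ae_of_all _ fun x => ?_)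
    simp only
    rw [← SchwartzMap.mul_eq_integral_exp hf x, hF]
    push_cast
    rfl
  have i2 : ∫ x, (g x : ℂ) ∂μ = ∫ t, f t * charFun μ t := by
    rw [← integral_integral_exp_mul μ f.integrable]
    exact integral_congr_ae (ae_of_all _ hgf)
  have i3 : ∫ x, ((deriv g x : ℝ) : ℂ) ∂μ = ∫ t : ℝ, Complex.I * t * f t * charFun μ t := by
    rw [← integral_integral_exp_mul μ htf]
    exact integral_congr_ae (ae_of_all _ fun x =>
      (hdF x).trans (SchwartzMap.deriv_eq_integral_exp hf x))
  have i4 : ∫ x, (jumpPart ν g x : ℂ) ∂μ = ∫ t, f t * jumpSymbol ν t * charFun μ t := by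
    rw [← integral_integral_exp_mul μ hfs]
    exact integral_congr_ae (ae_of_all _ (jumpPart_eq_integral_exp hw hgf))
  have split : ∀ t : ℝ, Complex.I * f t *
      ((Complex.I * β - (σ : ℂ) ^ 2 * t + Complex.I * jumpSymbol ν t) * charFun μ t)
      = -(β * (f t * charFun μ t)) - (σ : ℂ) ^ 2 * (Complex.I * t * f t * charFun μ t)
        - f t * jumpSymbol ν t * charFun μ t := fun t => by
    linear_combination (f t * charFun μ t * β + f t * charFun μ t * jumpSymbol ν t)
      * Complex.I_mul_I
  have hA := (mulφ f.integrable).const_mul (β : ℂ)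
  have hB := (mulφ htf).const_mul ((σ : ℂ) ^ 2)
  have hC := mulφ hfs
  have hA' : Integrable fun t => -((β : ℂ) * (f t * charFun μ t)) := hA.neg
  have hAB : Integrable fun t => -((β : ℂ) * (f t * charFun μ t))
      - (σ : ℂ) ^ 2 * (Complex.I * t * f t * charFun μ t) := hA'.sub hB
  -- Integration by parts moves the derivative from `f` to `φ`, where `φ' = ψ' φ` applies; `split`
  -- sorts `i f φ'` into the drift, Gaussian and jump terms.
  have ibp := integral_mul_deriv_eq_deriv_mul_of_integrable (u := fun t => Complex.I * f t)
    (v := charFun μ) (u' := fun t => Complex.I * deriv f t)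
    (fun t _ => f.differentiableAt.hasDerivAt.const_mul Complex.I) (fun t _ => hφd t)
    ((hAB.sub hC).congr (ae_of_all _ fun t => (split t).symm))
    (mulφ (hd.const_mul Complex.I)) (mulφ (f.integrable.const_mul Complex.I))
  simp_rw [split] at ibp
  rw [integral_sub hAB hC, integral_sub hA' hB, integral_neg, integral_const_mul,
    integral_const_mul, ← i1, ← i2, ← i3, ← i4] at ibp
  simp only [integral_complex_ofReal] at ibp
  have hx : ∫ x, (x - β) * g x ∂μ = ∫ x, x * g x ∂μ - β * ∫ x, g x ∂μ := by
    rw [← integral_const_mul, ← integral_sub]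
    · exact integral_congr_ae (ae_of_all _ fun x => by simp only; ring)
    · simpa using integrable_sub_mul hg 0 μ
    · obtain ⟨C, hC⟩ := hg.2.1
      exact (integrable_of_abs_le_const hg.1.continuous hC μ).const_mul β
  rw [hx]
  have : ((∫ x, x * g x ∂μ - β * ∫ x, g x ∂μ : ℝ) : ℂ)
      = ((σ ^ 2 * ∫ x, deriv g x ∂μ + ∫ x, jumpPart ν g x ∂μ : ℝ) : ℂ) := by
    push_cast
    linear_combination ibp
  exact_mod_cast this

/-! ### Compound Poisson laws -/

/-- The convolution powers of a measure. -/
noncomputable def convPow (η : Measure ℝ) : ℕ → Measure ℝ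
  | 0 => Measure.dirac 0
  | n + 1 => convPow η n ∗ η

instance isFiniteMeasure_convPow (η : Measure ℝ) [IsFiniteMeasure η] (n : ℕ) :
    IsFiniteMeasure (convPow η n) := by
  induction n with
  | zero => exact inferInstanceAs (IsFiniteMeasure (Measure.dirac (0 : ℝ)))
  | succ n ih => exact inferInstanceAs (IsFiniteMeasure (convPow η n ∗ η))

lemma charFun_convPow (η : Measure ℝ) [IsFiniteMeasure η] (n : ℕ) (t : ℝ) :
    charFun (convPow η n) t = charFun η t ^ n := by
  induction n with
  | zero => simp [convPow, charFun_dirac]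
  | succ n ih => rw [convPow, charFun_conv, ih, pow_succ]

lemma real_univ_convPow (η : Measure ℝ) [IsFiniteMeasure η] (n : ℕ) :
    (convPow η n).real Set.univ = η.real Set.univ ^ n := by
  have := charFun_convPow η n 0
  rw [charFun_zero, charFun_zero] at this
  exact_mod_cast this

/-- The compound Poisson law with jump measure `η`. -/
noncomputable def compoundPoisson (η : Measure ℝ) : Measure ℝ :=
  Measure.sum fun n : ℕ =>
    ENNReal.ofReal (Real.exp (-η.real Set.univ) / n.factorial) • convPow η n

/-- Used at `z = η(ℝ)` for finiteness of the total mass and at `z = charFun η t` for the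
characteristic function. -/
lemma hasSum_charFun_compoundPoisson (η : Measure ℝ) (z : ℂ) :
    HasSum (fun n : ℕ => ((Real.exp (-η.real Set.univ) / n.factorial : ℝ) : ℂ) * z ^ n)
      (Complex.exp (z - η.real Set.univ)) := by
  have h1 : HasSum (fun n : ℕ => z ^ n / n.factorial) (Complex.exp z) := by
    rw [Complex.exp_eq_exp_ℂ]; exact NormedSpace.expSeries_div_hasSum_exp z
  have h2 := h1.mul_left (Complex.exp (-η.real Set.univ))
  rw [← Complex.exp_add, neg_add_eq_sub] at h2
  refine h2.congr_fun fun n => ?_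
  push_cast
  ring

instance isFiniteMeasure_compoundPoisson (η : Measure ℝ) [IsFiniteMeasure η] :
    IsFiniteMeasure (compoundPoisson η) := by
  refine ⟨?_⟩
  rw [compoundPoisson, Measure.sum_apply _ MeasurableSet.univ]
  have h : Summable fun n : ℕ =>
      Real.exp (-η.real Set.univ) / n.factorial * η.real Set.univ ^ n := by
    have := (hasSum_charFun_compoundPoisson η (η.real Set.univ : ℂ)).summable
    exact_mod_cast this
  convert h.tsum_ofReal_lt_top with n
  rw [Measure.smul_apply, smul_eq_mul, ← real_univ_convPow,
    ENNReal.ofReal_mul (by positivity), ofReal_measureReal]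

lemma charFun_compoundPoisson (η : Measure ℝ) [IsFiniteMeasure η] (t : ℝ) :
    charFun (compoundPoisson η) t
      = Complex.exp (∫ u : ℝ, (Complex.exp (Complex.I * t * u) - 1) ∂η) := by
  have hint : ∀ ρ : Measure ℝ, IsFiniteMeasure ρ →
      Integrable (fun x : ℝ => Complex.exp (t * x * Complex.I)) ρ := fun ρ _ => by
    refine Integrable.of_bound (Continuous.aestronglyMeasurable (by fun_prop)) 1
      (ae_of_all _ fun x => ?_)
    rw [← Complex.ofReal_mul, Complex.norm_exp_ofReal_mul_I]
  have h1 : charFun η t - η.real Set.univ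
      = ∫ u : ℝ, (Complex.exp (Complex.I * t * u) - 1) ∂η := by
    have : ∀ u : ℝ, Complex.I * t * u = t * u * Complex.I := fun u => by ring
    simp_rw [this]
    rw [integral_sub (hint η inferInstance) (integrable_const _), charFun_apply_real]
    simp
  rw [← h1, ← (hasSum_charFun_compoundPoisson η (charFun η t)).tsum_eq, charFun_apply_real]
  have h2 := hasSum_integral_measure (hint (compoundPoisson η) inferInstance)
  refine h2.tsum_eq.symm.trans (tsum_congr fun n => ?_)
  rw [integral_smul_measure, ← charFun_apply_real, charFun_convPow,
    ENNReal.toReal_ofReal (by positivity), Complex.real_smul]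

instance isProbabilityMeasure_compoundPoisson (η : Measure ℝ) [IsFiniteMeasure η] :
    IsProbabilityMeasure (compoundPoisson η) := by
  have h := charFun_compoundPoisson η 0
  rw [charFun_zero] at h
  simp only [Complex.ofReal_zero, mul_zero, zero_mul, Complex.exp_zero, sub_self,
    integral_zero] at h
  have h' : (compoundPoisson η).real Set.univ = 1 := by exact_mod_cast h
  exact ⟨by rw [← ofReal_measureReal, h', ENNReal.ofReal_one]⟩

/-- This is the `n = 0` term of the Poisson series: no jump occurs. -/
lemma smul_dirac_le_compoundPoisson (η : Measure ℝ) :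
    ENNReal.ofReal (Real.exp (-η.real Set.univ)) • Measure.dirac 0 ≤ compoundPoisson η := by
  have := Measure.le_sum (fun n : ℕ =>
    ENNReal.ofReal (Real.exp (-η.real Set.univ) / n.factorial) • convPow η n) 0
  simpa [convPow, compoundPoisson] using this

/-! ### Infinitely divisible laws of finite variation -/

/-- A pointwise limit of characteristic functions that is continuous at `0` is a characteristic
function. -/
lemma exists_charFun_eq_of_tendsto {μ : ℕ → Measure ℝ} [∀ n, IsProbabilityMeasure (μ n)]
    {f : ℝ → ℂ} (hf : ContinuousAt f 0)
    (h : ∀ t, Tendsto (fun n => charFun (μ n) t) atTop (𝓝 (f t))) :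
    ∃ μ₀ : Measure ℝ, IsProbabilityMeasure μ₀ ∧ ∀ t, charFun μ₀ t = f t := by
  let m : ℕ → ProbabilityMeasure ℝ := fun n => ⟨μ n, inferInstance⟩
  have ht : IsTightMeasureSet {((ρ : ProbabilityMeasure ℝ) : Measure ℝ) | ρ ∈ Set.range m} := by
    have e : {((ρ : ProbabilityMeasure ℝ) : Measure ℝ) | ρ ∈ Set.range m} = Set.range μ := by
      ext ρ; exact Set.exists_range_iff
    rw [e]
    exact isTightMeasureSet_of_tendsto_charFun hf h
  have hc := isCompact_closure_of_isTightMeasureSet ht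
  -- Continuity at `0` gives tightness, hence relative compactness; an ultrafilter finer than
  -- `atTop` selects a limit point, and `charFun (μ n) t` still tends to `f t` along it.
  let U : Ultrafilter ℕ := Ultrafilter.of atTop
  obtain ⟨ρ, -, hρ⟩ := hc.ultrafilter_le_nhds (U.map m)
    (le_principal_iff.2 (Filter.mem_map.2 (Eventually.of_forall fun n =>
      subset_closure ⟨n, rfl⟩)))
  have hρ' : Tendsto m U (𝓝 ρ) := hρ
  refine ⟨ρ, inferInstance, fun t => ?_⟩
  rw [ProbabilityMeasure.tendsto_iff_forall_integral_rclike_tendsto ℂ] at hρ'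
  have h1 := hρ' (BoundedContinuousFunction.innerProbChar t)
  simp_rw [← charFun_eq_integral_innerProbChar] at h1
  exact tendsto_nhds_unique h1 ((h t).mono_left (Ultrafilter.of_le atTop))

lemma norm_exp_I_mul_sub_one_le (t u : ℝ) :
    ‖Complex.exp (Complex.I * t * u) - 1‖ ≤ (2 + |t|) * min 1 |u| := by
  have e : (Complex.I * t * u : ℂ) = Complex.I * (t * u : ℝ) := by push_cast; ring
  rw [e]
  rcases le_or_gt |u| 1 with hu | hu
  · have := Real.norm_exp_I_mul_ofReal_sub_one_le (x := t * u)
    rw [Real.norm_eq_abs, abs_mul] at this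
    rw [min_eq_right hu]
    nlinarith [abs_nonneg u]
  · have := norm_sub_le (Complex.exp (Complex.I * (t * u : ℝ))) 1
    rw [norm_exp_I_mul, norm_one] at this
    rw [min_eq_left hu.le]
    nlinarith [abs_nonneg t]

lemma integrable_exp_I_mul_sub_one {ν : Measure ℝ} (h : Integrable (fun u => min 1 |u|) ν)
    (t : ℝ) : Integrable (fun u : ℝ => Complex.exp (Complex.I * t * u) - 1) ν :=
  (h.const_mul (2 + |t|)).mono' (Continuous.aestronglyMeasurable (by fun_prop))
    (ae_of_all _ (norm_exp_I_mul_sub_one_le t))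

lemma IsLevyMeasure.integrable_min_one_abs {ν : Measure ℝ} (h : IsLevyMeasure ν)
    (hs : IntegrableOn (fun u : ℝ => u) {u | |u| ≤ 1} ν) :
    Integrable (fun u => min 1 |u|) ν := by
  have h1 := (integrable_indicator_iff (measurableSet_abs_le 1)).2 hs.abs
  refine (h1.add h.integrable_min).mono' (by fun_prop) (ae_of_all _ fun u => ?_)
  rw [Real.norm_eq_abs, abs_of_nonneg (by positivity)]
  simp only [Pi.add_apply]
  rcases le_or_gt |u| 1 with hu | hu
  · rw [Set.indicator_of_mem (show u ∈ {u : ℝ | |u| ≤ 1} from hu)]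
    exact (min_le_right _ _).trans (le_add_of_nonneg_right (by positivity))
  · rw [Set.indicator_of_notMem (show u ∉ {u : ℝ | |u| ≤ 1} from not_le.2 hu), zero_add]
    have : 1 ≤ u ^ 2 := by rw [← sq_abs]; exact one_le_pow₀ hu.le
    rw [min_eq_left this]
    exact min_le_left _ _

/-- Existence of the infinitely divisible law with drift `b` and a Lévy measure integrating
`1 ∧ |u|`. -/
lemma exists_charFun_eq_exp_drift {ν : Measure ℝ} (hν : IsLevyMeasure ν)
    (h : Integrable (fun u => min 1 |u|) ν) (b : ℝ) :
    ∃ μ : Measure ℝ, IsProbabilityMeasure μ ∧ ∀ t : ℝ, charFun μ t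
      = Complex.exp (Complex.I * t * b + ∫ u : ℝ, (Complex.exp (Complex.I * t * u) - 1) ∂ν) := by
  -- Dropping the jumps of size at most `1/(n+1)` leaves a finite jump measure, hence a compound
  -- Poisson law shifted by `b`.
  let s : ℕ → Set ℝ := fun n => {u : ℝ | 1 / ((n : ℝ) + 1) < |u|}
  have hs : ∀ n, MeasurableSet (s n) := fun n => measurableSet_lt_abs _
  have hfin : ∀ n, IsFiniteMeasure (ν.restrict (s n)) := fun n =>
    ⟨by rw [Measure.restrict_apply_univ]; exact hν.measure_lt_abs_lt_top (by positivity)⟩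
  let m : ℕ → Measure ℝ := fun n => compoundPoisson (ν.restrict (s n)) ∗ Measure.dirac b
  have hm : ∀ n, IsProbabilityMeasure (m n) := fun n => by
    have := hfin n
    exact inferInstanceAs (IsProbabilityMeasure (_ ∗ _))
  have hne : ∀ᵐ u ∂ν, u ≠ 0 := by
    rw [ae_iff]; simpa using hν.zero
  refine exists_charFun_eq_of_tendsto (μ := m) ?_ fun t => ?_
  · refine Complex.continuous_exp.continuousAt.comp (ContinuousAt.add
      (Continuous.continuousAt (by fun_prop)) ?_)
    refine continuousAt_of_dominated (bound := fun u => 3 * min 1 |u|)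
      (Eventually.of_forall fun t => Continuous.aestronglyMeasurable (by fun_prop)) ?_
      (h.const_mul 3) (ae_of_all _ fun u => Continuous.continuousAt (by fun_prop))
    filter_upwards [Metric.ball_mem_nhds (0 : ℝ) one_pos] with t ht
    refine ae_of_all _ fun u => (norm_exp_I_mul_sub_one_le t u).trans ?_
    have : |t| ≤ 1 := by
      rw [Metric.mem_ball, dist_zero_right, Real.norm_eq_abs] at ht; exact ht.le
    gcongr
    linarith
  · have hcf : ∀ n, charFun (m n) t = Complex.exp (Complex.I * t * b
        + ∫ u in s n, (Complex.exp (Complex.I * t * u) - 1) ∂ν) := fun n => by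
      have := hfin n
      rw [charFun_conv, charFun_compoundPoisson, charFun_dirac, ← Complex.exp_add, add_comm]
      congr 2
      simp
      ring
    simp_rw [hcf]
    refine (Complex.continuous_exp.tendsto _).comp (Tendsto.const_add _ ?_)
    simp_rw [← integral_indicator (hs _)]
    refine tendsto_integral_of_dominated_convergence (fun u => (2 + |t|) * min 1 |u|)
      (fun n => AEStronglyMeasurable.indicator
        (Continuous.aestronglyMeasurable (by fun_prop)) (hs n)) (h.const_mul _)
      (fun n => ae_of_all _ fun u =>
        (norm_indicator_le_norm_self _ _).trans (norm_exp_I_mul_sub_one_le t u)) ?_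
    filter_upwards [hne] with u hu
    refine tendsto_const_nhds.congr' ?_
    have h0 : Tendsto (fun n : ℕ => 1 / ((n : ℝ) + 1)) atTop (𝓝 0) :=
      tendsto_one_div_add_atTop_nhds_zero_nat
    filter_upwards [h0.eventually_lt_const (abs_pos.2 hu)] with n hn
    rw [Set.indicator_of_mem (show u ∈ s n from hn)]

lemma setIntegral_abs_le_one_eq (ν : Measure ℝ) :
    ∫ u in {u : ℝ | |u| ≤ 1}, u ∂ν = ∫ u : ℝ, u * smallJump u ∂ν := by
  rw [← integral_indicator (measurableSet_abs_le 1)]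
  refine integral_congr_ae (ae_of_all _ fun u => ?_)
  by_cases hu : |u| ≤ 1 <;> simp [smallJump, hu]

/-- The exponent in terms of the drift, for a Lévy measure integrating `1 ∧ |u|`. -/
lemma levyExponent_eq_drift {ν : Measure ℝ} (hν : IsLevyMeasure ν)
    (hs : IntegrableOn (fun u : ℝ => u) {u | |u| ≤ 1} ν) {β σ : ℝ} (hσ : σ ^ 2 = 0) (t : ℝ) :
    levyExponent β σ ν t = Complex.I * t * levyDrift β ν
      + ∫ u : ℝ, (Complex.exp (Complex.I * t * u) - 1) ∂ν := by
  have h1 := integrable_exp_I_mul_sub_one (hν.integrable_min_one_abs hs) t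
  have h2 : Integrable (fun u : ℝ => ((u * smallJump u : ℝ) : ℂ)) ν := by
    have := (integrable_indicator_iff (measurableSet_abs_le 1)).2 hs
    refine this.ofReal.congr (ae_of_all _ fun u => ?_)
    by_cases hu : |u| ≤ 1 <;> simp [smallJump, hu]
  have h4 : ∫ u : ℝ, (Complex.exp (Complex.I * t * u) - 1 - Complex.I * t * u * smallJump u) ∂ν
      = ∫ u : ℝ, (Complex.exp (Complex.I * t * u) - 1) ∂ν
        - Complex.I * t * ((∫ u : ℝ, u * smallJump u ∂ν : ℝ) : ℂ) := by
    rw [← integral_complex_ofReal, ← integral_const_mul, ← integral_sub h1 (h2.const_mul _)]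
    refine integral_congr_ae (ae_of_all _ fun u => ?_)
    simp only
    push_cast
    ring
  have hσ' : (σ : ℂ) ^ 2 = 0 := by exact_mod_cast hσ
  rw [levyExponent, levyDrift, setIntegral_abs_le_one_eq, h4, hσ']
  push_cast
  ring

/-- Removing the large jumps: the law decomposes as a convolution with a compound Poisson law, and
in particular dominates a multiple of the law with truncated Lévy measure. -/
lemma exists_truncated_law {μ ν : Measure ℝ} [IsProbabilityMeasure μ] (hν : IsLevyMeasure ν)
    (h : Integrable (fun u => min 1 |u|) ν) {b : ℝ}
    (hφ : ∀ t : ℝ, charFun μ t = Complex.exp (Complex.I * t * b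
      + ∫ u : ℝ, (Complex.exp (Complex.I * t * u) - 1) ∂ν)) {r : ℝ} (hr : 0 < r) :
    ∃ ρ : Measure ℝ, IsProbabilityMeasure ρ ∧
      (∀ t : ℝ, charFun ρ t = Complex.exp (Complex.I * t * b
        + ∫ u in {u : ℝ | |u| ≤ r}, (Complex.exp (Complex.I * t * u) - 1) ∂ν)) ∧
      ENNReal.ofReal (Real.exp (-ν.real {u : ℝ | r < |u|})) • ρ ≤ μ := by
  obtain ⟨ρ, hρ, hρφ⟩ := exists_charFun_eq_exp_drift (hν.restrict {u : ℝ | |u| ≤ r})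
    h.integrableOn b
  refine ⟨ρ, hρ, hρφ, ?_⟩
  have hfin : IsFiniteMeasure (ν.restrict {u : ℝ | r < |u|}) :=
    ⟨by rw [Measure.restrict_apply_univ]; exact hν.measure_lt_abs_lt_top hr⟩
  set η := ν.restrict {u : ℝ | r < |u|} with hη
  have hμ : μ = compoundPoisson η ∗ ρ := by
    refine Measure.ext_of_charFun (funext fun t => ?_)
    rw [charFun_conv, charFun_compoundPoisson, hρφ, hφ, ← Complex.exp_add,
      ← integral_add_compl (measurableSet_abs_le r) (integrable_exp_I_mul_sub_one h t),
      compl_abs_le]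
    congr 1
    ring
  have hr' : ν.real {u : ℝ | r < |u|} = η.real Set.univ := by
    rw [hη, measureReal_restrict_apply_univ]
  rw [hμ, hr']
  -- Keeping only the no-jump atom of the compound Poisson factor leaves a multiple of `ρ` below
  -- `μ`.
  calc _ = (ENNReal.ofReal (Real.exp (-η.real Set.univ)) • Measure.dirac 0) ∗ ρ := by
        rw [Measure.conv_smul_left, Measure.dirac_zero_conv]
    _ ≤ _ := by
        unfold Measure.conv
        exact Measure.map_mono (Measure.prod_mono (smul_dirac_le_compoundPoisson η) le_rfl)
          (by fun_prop)

/-! ### The Stein identity for integrable jumps -/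

/-- `∫ u g(x+u) ν(du)`. -/
noncomputable def shiftPart (ν : Measure ℝ) (g : ℝ → ℝ) (x : ℝ) : ℝ := ∫ u, u * g (x + u) ∂ν

lemma exists_decay_bound {g : ℝ → ℝ} (hg : g ∈ steinClass) (m : ℕ) :
    ∃ C : ℝ, 0 ≤ C ∧ ∀ x, (1 + |x|) ^ m * |g x| ≤ C := by
  obtain ⟨C0, h0, hC0⟩ := exists_deriv_bound hg 0 0
  obtain ⟨C1, h1, hC1⟩ := exists_deriv_bound hg m 0
  simp only [pow_zero, one_mul, iteratedDeriv_zero] at hC0 hC1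
  refine ⟨2 ^ m * (C0 + C1), by positivity, fun x => ?_⟩
  have h2 : (1 + |x|) ^ m ≤ 2 ^ m * (1 + |x| ^ m) := by
    rcases le_total |x| 1 with h | h
    · calc (1 + |x|) ^ m ≤ 2 ^ m := by gcongr; linarith
        _ ≤ _ := le_mul_of_one_le_right (by positivity) (by linarith [pow_nonneg (abs_nonneg x) m])
    · calc (1 + |x|) ^ m ≤ (2 * |x|) ^ m := by gcongr; linarith
        _ = 2 ^ m * |x| ^ m := mul_pow _ _ _
        _ ≤ _ := by gcongr; linarith
  calc (1 + |x|) ^ m * |g x| ≤ 2 ^ m * (1 + |x| ^ m) * |g x| := by gcongr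
    _ = 2 ^ m * (|g x| + |x| ^ m * |g x|) := by ring
    _ ≤ _ := by gcongr; exacts [hC0 x, hC1 x]

lemma measurable_mul_shift {g : ℝ → ℝ} (hg : g ∈ steinClass) :
    Measurable fun p : ℝ × ℝ => p.2 * g (p.1 + p.2) := by
  have := hg.1.continuous.measurable
  fun_prop

/-- No moment of the large jumps is needed: `|u| ≤ |x+u| + |x|`, and the decay of `g` absorbs
`|x+u|`. -/
lemma integrable_mul_shift {ν : Measure ℝ} (h : Integrable (fun u => min 1 |u|) ν) {g : ℝ → ℝ}
    (hg : g ∈ steinClass) (x : ℝ) : Integrable (fun u => u * g (x + u)) ν := by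
  obtain ⟨C, hC0, hC⟩ := exists_decay_bound hg 1
  refine (h.const_mul (C * (1 + |x|))).mono'
    ((measurable_mul_shift hg).comp measurable_prodMk_left).aestronglyMeasurable
    (ae_of_all _ fun u => ?_)
  rw [norm_mul, Real.norm_eq_abs, Real.norm_eq_abs]
  have h1 := hC (x + u)
  rw [pow_one] at h1
  have h2 : |g (x + u)| ≤ C := by nlinarith [abs_nonneg (x + u), abs_nonneg (g (x + u))]
  rcases le_or_gt |u| 1 with hu | hu
  · rw [min_eq_right hu]
    nlinarith [abs_nonneg x, abs_nonneg u, mul_nonneg (mul_nonneg hC0 (abs_nonneg x)) (abs_nonneg u),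
      mul_le_mul_of_nonneg_left h2 (abs_nonneg u)]
  · rw [min_eq_left hu.le]
    have h3 : |u| ≤ |x + u| + |x| := by
      have := abs_sub (x + u) x
      rwa [add_sub_cancel_left] at this
    calc |u| * |g (x + u)| ≤ (|x + u| + |x|) * |g (x + u)| := by gcongr
      _ ≤ (1 + |x + u|) * |g (x + u)| + |x| * |g (x + u)| := by nlinarith [abs_nonneg (g (x + u))]
      _ ≤ C + |x| * C := by gcongr
      _ = _ := by ring

lemma measurable_shiftPart (ν : Measure ℝ) [SFinite ν] {g : ℝ → ℝ} (hg : g ∈ steinClass) :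
    Measurable (shiftPart ν g) :=
  (measurable_mul_shift hg).stronglyMeasurable.integral_prod_right.measurable

/-- The Stein identity without compensation, when the Lévy measure integrates `|u|`. -/
lemma stein_identity_drift {ρ ν : Measure ℝ} [IsProbabilityMeasure ρ] (hν : IsLevyMeasure ν)
    (hu : Integrable (fun u : ℝ => u) ν) {b : ℝ}
    (hφ : ∀ t : ℝ, charFun ρ t = Complex.exp (Complex.I * t * b
      + ∫ u : ℝ, (Complex.exp (Complex.I * t * u) - 1) ∂ν))
    {g : ℝ → ℝ} (hg : g ∈ steinClass) :
    Integrable (shiftPart ν g) ρ ∧ ∫ x, (x - b) * g x ∂ρ = ∫ x, shiftPart ν g x ∂ρ := by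
  have := hν.sigmaFinite
  have hw := hν.integrable_jumpWeight hu.integrableOn
  have hmin := hν.integrable_min_one_abs hu.integrableOn
  set d := ∫ u in {u : ℝ | |u| ≤ 1}, u ∂ν with hd
  have hus : Integrable (fun u : ℝ => u * smallJump u) ν :=
    hu.mul_bdd (c := 1) measurable_smallJump.aestronglyMeasurable
      (ae_of_all _ abs_smallJump_le_one)
  have hj : ∀ x, jumpPart ν g x = shiftPart ν g x - d * g x := fun x => by
    rw [jumpPart, shiftPart, hd, setIntegral_abs_le_one_eq, ← integral_mul_const,
      ← integral_sub (integrable_mul_shift hmin hg x) (hus.mul_const _)]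
    exact integral_congr_ae (ae_of_all _ fun u => by simp only; ring)
  have hgi : Integrable g ρ := by
    obtain ⟨C, hC⟩ := hg.2.1
    exact integrable_of_abs_le_const hg.1.continuous hC ρ
  have hjint := integrable_jumpPart hw hg ρ
  have hs : Integrable (shiftPart ν g) ρ :=
    (hjint.add (hgi.const_mul d)).congr (ae_of_all _ fun x => by
      simp only [Pi.add_apply, hj]; ring)
  refine ⟨hs, ?_⟩
  -- Adding back `d = ∫_{|u| ≤ 1} u ν(du)` makes the drift of the triplet equal to `b`.
  have key := stein_identity (μ := ρ) (β := b + d) (σ := 0) hν hw (fun t => by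
    rw [hφ, levyExponent_eq_drift hν hu.integrableOn (by norm_num), levyDrift, ← hd,
      add_sub_cancel_right]) hg
  simp_rw [hj] at key
  rw [integral_sub hs (hgi.const_mul d), zero_pow two_ne_zero, zero_mul, zero_add] at key
  have e : ∫ x, (x - (b + d)) * g x ∂ρ = ∫ x, (x - b) * g x ∂ρ - ∫ x, d * g x ∂ρ := by
    rw [← integral_sub (integrable_sub_mul hg b ρ) (hgi.const_mul d)]
    exact integral_congr_ae (ae_of_all _ fun x => by simp only; ring)
  linarith

/-! ### The cutoff error -/

lemma tsum_ite_between_le (a b : ℝ) (hab : a ≤ b) (c : ENNReal) :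
    ∑' n : ℕ, (if a ≤ (n : ℝ) + 1 ∧ (n : ℝ) + 1 < b then c else 0)
      ≤ ENNReal.ofReal (b - a + 1) * c := by
  have hsub : ∀ n ∉ Finset.Ico ⌈a - 1⌉₊ ⌈b - 1⌉₊,
      (if a ≤ (n : ℝ) + 1 ∧ (n : ℝ) + 1 < b then c else 0) = 0 := fun n hn => by
    refine if_neg fun h => hn (Finset.mem_Ico.2 ⟨Nat.ceil_le.2 (by linarith), ?_⟩)
    exact Nat.lt_ceil.2 (by linarith)
  rw [tsum_eq_sum hsub]
  calc _ ≤ ∑ _n ∈ Finset.Ico ⌈a - 1⌉₊ ⌈b - 1⌉₊, c :=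
        Finset.sum_le_sum fun n _ => by split_ifs <;> simp
    _ = ((⌈b - 1⌉₊ - ⌈a - 1⌉₊ : ℕ) : ENNReal) * c := by simp
    _ ≤ _ := by
        gcongr
        rw [← ENNReal.ofReal_natCast]
        refine ENNReal.ofReal_le_ofReal ?_
        rcases le_total ⌈b - 1⌉₊ ⌈a - 1⌉₊ with h | h
        · rw [Nat.sub_eq_zero_of_le h, Nat.cast_zero]; linarith
        · rw [Nat.cast_sub h]
          have h1 := Nat.le_ceil (a - 1)
          -- The natural-number ceiling of a negative number is `0`, so the bound `⌈b - 1⌉₊ < b`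
          -- needs `b ≥ 1`.
          rcases le_or_gt (b - 1) 0 with h2 | h2
          · rw [Nat.ceil_eq_zero.2 h2]
            have : (0 : ℝ) ≤ ⌈a - 1⌉₊ := Nat.cast_nonneg _
            push_cast
            linarith
          · have := Nat.ceil_lt_add_one h2.le
            linarith

/-- `|u g(x+u)|` where exactly one of `|u| ≤ r`, `|x| ≤ r` holds, and `0` elsewhere. -/
noncomputable def cutoffKernel (g : ℝ → ℝ) (r x u : ℝ) : ℝ :=
  |u * g (x + u) * ({y : ℝ | |y| ≤ r}.indicator 1 u - {y : ℝ | |y| ≤ r}.indicator 1 x)|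

lemma measurable_cutoffKernel {g : ℝ → ℝ} (hg : g ∈ steinClass) (r : ℝ) :
    Measurable fun p : ℝ × ℝ => cutoffKernel g r p.1 p.2 := by
  have h1 := measurable_mul_shift hg
  have h2 : Measurable ({y : ℝ | |y| ≤ r}.indicator (1 : ℝ → ℝ)) :=
    measurable_one.indicator (measurableSet_abs_le r)
  unfold cutoffKernel
  exact (h1.mul ((h2.comp measurable_snd).sub (h2.comp measurable_fst))).norm

/-- A level `r = n + 1` contributes only if `min(|x|,|u|) ≤ r < max(|x|,|u|)`, an interval of length
at most `|x+u|`. On it `|u|/r ≤ (1 + |x+u|) (1 ∧ |u|)`: either `|u| ≤ r`, or `|x| ≤ r < |u|` and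
`|u| ≤ |x+u| + r`. The count and this bound cost one factor `1 + |x+u|` each, whence the square in
`hC`. -/
lemma tsum_cutoffKernel_le {g : ℝ → ℝ} {C : ℝ} (hC : ∀ x, (1 + |x|) ^ 2 * |g x| ≤ C) (x u : ℝ) :
    ∑' n : ℕ, ENNReal.ofReal (cutoffKernel g (n + 1) x u) / (n + 1)
      ≤ ENNReal.ofReal (C * min 1 |u|) := by
  set a := min |x| |u| with ha
  set b := max |x| |u| with hb
  have hab : b - a ≤ |x + u| := by
    rw [hb, ha, max_sub_min_eq_abs]
    have := abs_abs_sub_abs_le u (-x)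
    rwa [abs_neg, sub_neg_eq_add, add_comm u x] at this
  have hterm : ∀ n : ℕ, ENNReal.ofReal (cutoffKernel g (n + 1) x u) / (n + 1)
      ≤ if a ≤ (n : ℝ) + 1 ∧ (n : ℝ) + 1 < b then
          ENNReal.ofReal ((1 + |x + u|) * min 1 |u| * |g (x + u)|) else 0 := fun n => by
    have hr : (1 : ℝ) ≤ n + 1 := by linarith [Nat.cast_nonneg (α := ℝ) n]
    have hcast : ((n : ENNReal) + 1) = ENNReal.ofReal ((n : ℝ) + 1) := by
      rw [ENNReal.ofReal_add (by positivity) zero_le_one]; simp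
    rw [hcast, ← ENNReal.ofReal_div_of_pos (by positivity)]
    generalize (n : ℝ) + 1 = r at hr
    have hr0 : 0 < r := by linarith
    rcases le_or_gt |u| r with hu | hu <;> rcases le_or_gt |x| r with hx | hx
    · simp [cutoffKernel, hu, hx]
    · rw [if_pos ⟨(min_le_right _ _).trans hu, lt_max_of_lt_left hx⟩]
      refine ENNReal.ofReal_le_ofReal ?_
      have : cutoffKernel g r x u = |u| * |g (x + u)| := by
        simp [cutoffKernel, hu, not_le.2 hx, abs_mul]
      rw [this, mul_div_right_comm]
      gcongr
      have h1 : |u| / r ≤ min 1 |u| :=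
        le_min ((div_le_one hr0).2 hu) (div_le_self (abs_nonneg u) hr)
      have h2 : 0 ≤ min 1 |u| := by positivity
      nlinarith [abs_nonneg (x + u)]
    · rw [if_pos ⟨(min_le_left _ _).trans hx, lt_max_of_lt_right hu⟩]
      refine ENNReal.ofReal_le_ofReal ?_
      have : cutoffKernel g r x u = |u| * |g (x + u)| := by
        simp [cutoffKernel, not_le.2 hu, hx, abs_mul]
      rw [this, mul_div_right_comm, min_eq_left (by linarith), mul_one]
      gcongr
      rw [div_le_iff₀ hr0]
      have h3 : |u| ≤ |x + u| + |x| := by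
        have := abs_sub (x + u) x
        rwa [add_sub_cancel_left] at this
      nlinarith [abs_nonneg (x + u)]
    · simp [cutoffKernel, not_le.2 hu, not_le.2 hx]
  refine (ENNReal.tsum_le_tsum hterm).trans ((tsum_ite_between_le a b min_le_max _).trans ?_)
  rw [← ENNReal.ofReal_mul (by linarith [(min_le_max : a ≤ b)])]
  refine ENNReal.ofReal_le_ofReal ?_
  have h2 : 0 ≤ min 1 |u| := by positivity
  calc (b - a + 1) * ((1 + |x + u|) * min 1 |u| * |g (x + u)|)
      ≤ (1 + |x + u|) * ((1 + |x + u|) * min 1 |u| * |g (x + u)|) :=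
        mul_le_mul_of_nonneg_right (by linarith) (by positivity)
    _ = ((1 + |x + u|) ^ 2 * |g (x + u)|) * min 1 |u| := by ring
    _ ≤ _ := by gcongr; exact hC _

/-- The total cutoff error at level `r`. -/
noncomputable def cutoffError (μ ν : Measure ℝ) (g : ℝ → ℝ) (r : ℝ) : ENNReal :=
  ∫⁻ x, ∫⁻ u, ENNReal.ofReal (cutoffKernel g r x u) ∂ν ∂μ

lemma tsum_cutoffError_ne_top {μ ν : Measure ℝ} [IsFiniteMeasure μ] [SFinite ν]
    (h : Integrable (fun u => min 1 |u|) ν) {g : ℝ → ℝ} (hg : g ∈ steinClass) :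
    ∑' n : ℕ, cutoffError μ ν g (n + 1) / (n + 1) ≠ ⊤ := by
  obtain ⟨C, -, hC⟩ := exists_decay_bound hg 2
  have hm : ∀ r, Measurable fun p : ℝ × ℝ => ENNReal.ofReal (cutoffKernel g r p.1 p.2) :=
    fun r => (measurable_cutoffKernel hg r).ennreal_ofReal
  have hm1 : ∀ r x, Measurable fun u => ENNReal.ofReal (cutoffKernel g r x u) :=
    fun r x => (hm r).comp measurable_prodMk_left
  have e : ∑' n : ℕ, cutoffError μ ν g (n + 1) / (n + 1)
      = ∫⁻ x, ∫⁻ u, ∑' n : ℕ, ENNReal.ofReal (cutoffKernel g (n + 1) x u) / (n + 1) ∂ν ∂μ := by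
    simp_rw [div_eq_mul_inv]
    have h1 : ∀ x, ∫⁻ u, ∑' n : ℕ, ENNReal.ofReal (cutoffKernel g (n + 1) x u)
          * ((n : ENNReal) + 1)⁻¹ ∂ν
        = ∑' n : ℕ, (∫⁻ u, ENNReal.ofReal (cutoffKernel g (n + 1) x u) ∂ν)
          * ((n : ENNReal) + 1)⁻¹ := fun x => by
      rw [lintegral_tsum fun n => ((hm1 _ x).mul_const _).aemeasurable]
      exact tsum_congr fun n => lintegral_mul_const _ (hm1 _ x)
    simp_rw [h1]
    rw [lintegral_tsum fun n => ((hm _).lintegral_prod_right.mul_const _).aemeasurable]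
    exact tsum_congr fun n => (lintegral_mul_const _ (hm _).lintegral_prod_right).symm
  rw [e]
  refine ne_top_of_le_ne_top (b := ∫⁻ _x, ∫⁻ u, ENNReal.ofReal (C * min 1 |u|) ∂ν ∂μ) ?_
    (lintegral_mono fun x => lintegral_mono fun u => tsum_cutoffKernel_le hC x u)
  rw [lintegral_const]
  exact ENNReal.mul_ne_top (h.const_mul C).lintegral_lt_top.ne (measure_ne_top _ _)

/-- If eventually `a n > ε`, the series would dominate a multiple of the harmonic series. -/
lemma frequently_le_of_tsum_div_ne_top {a : ℕ → ENNReal}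
    (h : ∑' n : ℕ, a n / (n + 1) ≠ ⊤) {ε : ℝ} (hε : 0 < ε) :
    ∃ᶠ n in atTop, a n ≤ ENNReal.ofReal ε := by
  intro hev
  have hs := ENNReal.summable_toReal h
  have h2 : Summable fun n : ℕ => ε / ((n : ℝ) + 1) := by
    refine Summable.of_norm_bounded_eventually_nat hs ?_
    filter_upwards [hev] with n hn
    rw [Real.norm_of_nonneg (by positivity)]
    have hcast : ((n : ENNReal) + 1) = ENNReal.ofReal ((n : ℝ) + 1) := by
      rw [ENNReal.ofReal_add (by positivity) zero_le_one]; simp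
    have h3 : ENNReal.ofReal (ε / ((n : ℝ) + 1)) ≤ a n / (n + 1) := by
      rw [ENNReal.ofReal_div_of_pos (by positivity), hcast]
      exact ENNReal.div_le_div_right (not_le.1 hn).le _
    exact (ENNReal.ofReal_le_iff_le_toReal (ENNReal.ne_top_of_tsum_ne_top h n)).1 h3
  have h3 : Summable fun n : ℕ => 1 / ((n : ℝ) + 1) :=
    (h2.mul_left ε⁻¹).congr fun n => by field_simp
  have h4 : Summable fun n : ℕ => 1 / (n : ℝ) :=
    (summable_nat_add_iff 1).1 (h3.congr fun n => by push_cast; rfl)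
  exact Real.not_summable_one_div_natCast h4

/-! ### Passage to the limit -/

/-- The missing part `μ - κ n` has vanishing mass. As `S` may be unbounded, it is first replaced by
a bounded function close to it in `L¹(μ)`; domination by `μ` makes this error uniform in `n`. -/
lemma tendsto_integral_of_le_of_tendsto_mass {μ : Measure ℝ} [IsFiniteMeasure μ]
    {κ : ℕ → Measure ℝ} (hκ : ∀ n, κ n ≤ μ)
    (hm : Tendsto (fun n => (κ n).real Set.univ) atTop (𝓝 (μ.real Set.univ)))
    {S : ℝ → ℝ} (hS : Integrable S μ) :
    Tendsto (fun n => ∫ x, S x ∂κ n) atTop (𝓝 (∫ x, S x ∂μ)) := by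
  have hfin : ∀ n, IsFiniteMeasure (κ n) := fun n => isFiniteMeasure_of_le μ (hκ n)
  rw [Metric.tendsto_atTop]
  intro ε hε
  obtain ⟨f, hf, hfi⟩ := hS.exists_boundedContinuous_integral_sub_le (half_pos hε)
  have hm' : Tendsto (fun n => ‖f‖ * (μ.real Set.univ - (κ n).real Set.univ)) atTop (𝓝 0) := by
    simpa using (hm.const_sub (μ.real Set.univ)).const_mul ‖f‖
  obtain ⟨N, hN⟩ := Metric.tendsto_atTop.1 hm' (ε / 2) (half_pos hε)
  refine ⟨N, fun n hn => ?_⟩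
  have hfn := hfin n
  set ρ := μ - κ n with hρ
  have hρμ : ρ ≤ μ := Measure.sub_le
  have hρfin : IsFiniteMeasure ρ := isFiniteMeasure_of_le μ hρμ
  have hsum : μ = ρ + κ n := (Measure.sub_add_cancel_of_le (hκ n)).symm
  have e1 : ∫ x, S x ∂μ = ∫ x, S x ∂ρ + ∫ x, S x ∂κ n := by
    conv_lhs => rw [hsum]
    exact integral_add_measure (hS.mono_measure hρμ) (hS.mono_measure (hκ n))
  have e2 : ρ.real Set.univ = μ.real Set.univ - (κ n).real Set.univ := by
    conv_rhs => rw [hsum]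
    rw [measureReal_add_apply, add_sub_cancel_right]
  have e3 : ∫ x, S x ∂ρ = ∫ x, (S x - f x) ∂ρ + ∫ x, f x ∂ρ := by
    rw [integral_sub (hS.mono_measure hρμ) (hfi.mono_measure hρμ), sub_add_cancel]
  have e4 : |∫ x, (S x - f x) ∂ρ| ≤ ε / 2 :=
    (norm_integral_le_integral_norm _).trans ((integral_mono_measure hρμ
      (ae_of_all _ fun _ => norm_nonneg _) (hS.sub hfi).norm).trans hf)
  have e5 : |∫ x, f x ∂ρ| ≤ ‖f‖ * ρ.real Set.univ :=
    norm_integral_le_of_norm_le_const (ae_of_all _ f.norm_coe_le_norm)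
  have e6 := hN n hn
  rw [Real.dist_0_eq_abs, ← e2] at e6
  rw [Real.dist_eq, e1, e3]
  have e7 := abs_add_le (∫ x, (S x - f x) ∂ρ) (∫ x, f x ∂ρ)
  have e8 := le_abs_self (‖f‖ * ρ.real Set.univ)
  rw [show ∫ x, S x ∂κ n - (∫ x, (S x - f x) ∂ρ + ∫ x, f x ∂ρ + ∫ x, S x ∂κ n)
    = -(∫ x, (S x - f x) ∂ρ + ∫ x, f x ∂ρ) by ring, abs_neg]
  linarith

lemma tendsto_real_lt_abs_atTop {ν : Measure ℝ} (hν : IsLevyMeasure ν) :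
    Tendsto (fun n : ℕ => ν.real {u : ℝ | (n : ℝ) + 1 < |u|}) atTop (𝓝 0) := by
  have h := tendsto_measure_iInter_atTop (μ := ν) (s := fun n : ℕ => {u : ℝ | (n : ℝ) + 1 < |u|})
    (fun n => (measurableSet_lt_abs _).nullMeasurableSet)
    (fun m n hmn u hu => lt_of_le_of_lt (by gcongr) (show (n : ℝ) + 1 < |u| from hu))
    ⟨0, (hν.measure_lt_abs_lt_top (by positivity)).ne⟩
  have he : ⋂ n : ℕ, {u : ℝ | (n : ℝ) + 1 < |u|} = ∅ := by
    refine Set.eq_empty_of_forall_notMem fun u hu => ?_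
    obtain ⟨n, hn⟩ := exists_nat_gt |u|
    have : (n : ℝ) + 1 < |u| := Set.mem_iInter.1 hu n
    linarith
  rw [he, measure_empty] at h
  exact (ENNReal.tendsto_toReal ENNReal.zero_ne_top).comp h

/-- The Stein identity without moment assumptions, when the Stein operator is integrable. -/
theorem integral_stein_eq_zero {μ ν : Measure ℝ} [IsProbabilityMeasure μ] (hν : IsLevyMeasure ν)
    (h : Integrable (fun u => min 1 |u|) ν) {b : ℝ}
    (hφ : ∀ t : ℝ, charFun μ t = Complex.exp (Complex.I * t * b
      + ∫ u : ℝ, (Complex.exp (Complex.I * t * u) - 1) ∂ν))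
    {g : ℝ → ℝ} (hg : g ∈ steinClass)
    (hS : Integrable (fun x => (x - b) * g x - shiftPart ν g x) μ) :
    ∫ x, ((x - b) * g x - shiftPart ν g x) ∂μ = 0 := by
  have := hν.sigmaFinite
  have hlin := integrable_sub_mul hg b μ
  -- The term `(x - b) g(x)` is bounded, so integrability of the operator amounts to that of its
  -- jump part.
  have hh : Integrable (shiftPart ν g) μ := by
    refine (hlin.sub hS).congr (ae_of_all _ fun x => ?_)
    simp only [Pi.sub_apply]
    ring
  choose ρ hρ hρφ hρle using fun n : ℕ => exists_truncated_law hν h hφ (r := (n : ℝ) + 1)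
    (by positivity)
  let c : ℕ → ENNReal := fun n => ENNReal.ofReal (Real.exp (-ν.real {u : ℝ | (n : ℝ) + 1 < |u|}))
  let κ : ℕ → Measure ℝ := fun n => c n • ρ n
  have hκle : ∀ n, κ n ≤ μ := hρle
  have hκfin : ∀ n, IsFiniteMeasure (κ n) := fun n => isFiniteMeasure_of_le μ (hκle n)
  have hmass : Tendsto (fun n => (κ n).real Set.univ) atTop (𝓝 (μ.real Set.univ)) := by
    have h1 := (Real.continuous_exp.tendsto _).comp (tendsto_real_lt_abs_atTop hν).neg
    rw [neg_zero, Real.exp_zero] at h1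
    rw [probReal_univ]
    refine h1.congr fun n => ?_
    have := hρ n
    simp only [Function.comp, κ, c, measureReal_ennreal_smul_apply, probReal_univ, mul_one]
    rw [ENNReal.toReal_ofReal (Real.exp_pos _).le]
  have hlim := tendsto_integral_of_le_of_tendsto_mass hκle hmass hS
  let ind : ℕ → ℝ → ℝ := fun n => {y : ℝ | |y| ≤ (n : ℝ) + 1}.indicator 1
  have hind : ∀ n, Measurable (ind n) := fun n => measurable_one.indicator (measurableSet_abs_le _)
  have hind1 : ∀ n x, |ind n x| ≤ 1 := fun n x => by
    simp only [ind, Set.indicator_apply]; split_ifs <;> simp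
  have htail : Tendsto (fun n => ∫ x, |shiftPart ν g x * (1 - ind n x)| ∂μ) atTop (𝓝 0) := by
    have h0 : ∫ _x : ℝ, (0 : ℝ) ∂μ = 0 := integral_zero _ _
    rw [← h0]
    refine tendsto_integral_of_dominated_convergence (fun x => 2 * |shiftPart ν g x|)
      (fun n => ((measurable_shiftPart ν hg).mul ((hind n).const_sub 1)).norm.aestronglyMeasurable)
      (hh.abs.const_mul 2) (fun n => ae_of_all _ fun x => ?_) (ae_of_all _ fun x => ?_)
    · rw [Real.norm_eq_abs, abs_abs, abs_mul, mul_comm]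
      gcongr
      have := abs_le.1 (hind1 n x)
      exact abs_le.2 ⟨by linarith, by linarith⟩
    · refine tendsto_const_nhds.congr' ?_
      obtain ⟨N, hN⟩ := exists_nat_gt |x|
      filter_upwards [eventually_ge_atTop N] with n hn
      have hx : |x| ≤ (n : ℝ) + 1 := by
        have : (N : ℝ) ≤ n := by exact_mod_cast hn
        linarith
      simp [ind, hx]
  -- The truncated identity replaces the linear term by the truncated jump part; the full jump part
  -- is then split at `|x| = n + 1`, the same level as the cutoff in `u`.
  have hmain : ∀ n, |∫ x, ((x - b) * g x - shiftPart ν g x) ∂κ n|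
        ≤ |∫ x, (shiftPart (ν.restrict {u : ℝ | |u| ≤ (n : ℝ) + 1}) g x
            - shiftPart ν g x * ind n x) ∂κ n|
          + ∫ x, |shiftPart ν g x * (1 - ind n x)| ∂μ := fun n => by
    have hfn := hκfin n
    have := hρ n
    have hui : Integrable (fun u : ℝ => u) (ν.restrict {u : ℝ | |u| ≤ (n : ℝ) + 1}) := by
      refine Integrable.mono' (h.integrableOn.const_mul ((n : ℝ) + 1)) (by fun_prop) ?_
      refine (ae_restrict_iff' (measurableSet_abs_le _)).2 (ae_of_all _ fun u hu => ?_)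
      have hu' : |u| ≤ (n : ℝ) + 1 := hu
      rw [Real.norm_eq_abs]
      rcases le_total |u| 1 with h1 | h1
      · rw [min_eq_right h1]
        nlinarith [abs_nonneg u, Nat.cast_nonneg (α := ℝ) n]
      · rw [min_eq_left h1]; linarith
    obtain ⟨hi1, hi2⟩ := stein_identity_drift (hν.restrict _) hui (hρφ n) hg
    have hi1' : Integrable (shiftPart (ν.restrict {u : ℝ | |u| ≤ (n : ℝ) + 1}) g) (κ n) :=
      hi1.smul_measure ENNReal.ofReal_ne_top
    have hi2' : ∫ x, (x - b) * g x ∂κ n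
        = ∫ x, shiftPart (ν.restrict {u : ℝ | |u| ≤ (n : ℝ) + 1}) g x ∂κ n := by
      simp only [κ, integral_smul_measure, hi2]
    have hhκ := hh.mono_measure (hκle n)
    have hhi : Integrable (fun x => shiftPart ν g x * ind n x) μ :=
      hh.mul_bdd (c := 1) (hind n).aestronglyMeasurable (ae_of_all _ (hind1 n))
    have hhi' : Integrable (fun x => shiftPart ν g x * (1 - ind n x)) μ :=
      (hh.sub hhi).congr (ae_of_all _ fun x => by simp only [Pi.sub_apply]; ring)
    have hhiκ := hhi.mono_measure (hκle n)
    have hhiκ' := hhi'.mono_measure (hκle n)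
    have e : ∫ x, ((x - b) * g x - shiftPart ν g x) ∂κ n
        = ∫ x, (shiftPart (ν.restrict {u : ℝ | |u| ≤ (n : ℝ) + 1}) g x
            - shiftPart ν g x * ind n x) ∂κ n
          - ∫ x, shiftPart ν g x * (1 - ind n x) ∂κ n := by
      have e0 : ∫ x, shiftPart ν g x ∂κ n
          = ∫ x, shiftPart ν g x * ind n x ∂κ n + ∫ x, shiftPart ν g x * (1 - ind n x) ∂κ n := by
        rw [← integral_add hhiκ hhiκ']
        exact integral_congr_ae (ae_of_all _ fun x => by simp only; ring)
      rw [integral_sub (integrable_sub_mul hg b _) hhκ, hi2', integral_sub hi1' hhiκ, e0]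
      ring
    rw [e]
    refine (abs_sub _ _).trans (add_le_add le_rfl ?_)
    refine (norm_integral_le_integral_norm fun x => shiftPart ν g x * (1 - ind n x)).trans ?_
    exact integral_mono_measure (hκle n) (ae_of_all _ fun _ => norm_nonneg _) hhi'.norm
  have hcut : ∀ n, ‖∫ x, (shiftPart (ν.restrict {u : ℝ | |u| ≤ (n : ℝ) + 1}) g x
      - shiftPart ν g x * ind n x) ∂κ n‖ₑ ≤ cutoffError μ ν g (n + 1) := fun n => by
    refine (enorm_integral_le_lintegral_enorm _).trans ((lintegral_mono' (hκle n) le_rfl).trans ?_)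
    refine lintegral_mono fun x => ?_
    have hix := integrable_mul_shift h hg x
    have e : shiftPart (ν.restrict {u : ℝ | |u| ≤ (n : ℝ) + 1}) g x - shiftPart ν g x * ind n x
        = ∫ u, u * g (x + u) * (ind n u - ind n x) ∂ν := by
      have h1 : Integrable (fun u => u * g (x + u) * ind n u) ν :=
        hix.mul_bdd (c := 1) (hind n).aestronglyMeasurable (ae_of_all _ (hind1 n))
      rw [shiftPart, shiftPart, ← integral_indicator (measurableSet_abs_le _),
        ← integral_mul_const]
      have h2 : ∀ u, {u : ℝ | |u| ≤ (n : ℝ) + 1}.indicator (fun u => u * g (x + u)) u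
          = u * g (x + u) * ind n u := fun u => by
        simp only [ind, Set.indicator_apply]; split_ifs <;> simp
      simp_rw [h2]
      rw [← integral_sub h1 (hix.mul_const _)]
      exact integral_congr_ae (ae_of_all _ fun u => by simp only; ring)
    simp only
    rw [e]
    refine (enorm_integral_le_lintegral_enorm _).trans (lintegral_mono fun u => ?_)
    rw [Real.enorm_eq_ofReal_abs]
    rfl
  refine abs_eq_zero.1 (le_antisymm (le_of_forall_pos_le_add fun ε hε => ?_) (abs_nonneg _))
  rw [zero_add]
  have hlim' := hlim.abs.sub htail
  rw [sub_zero] at hlim'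
  -- The whole sequence converges, so a bound holding for infinitely many `n` passes to the limit.
  refine le_of_tendsto_of_frequently hlim'
    ((frequently_le_of_tsum_div_ne_top (tsum_cutoffError_ne_top (μ := μ) h hg) hε).mono
      fun n hn => ?_)
  have h1 := (hcut n).trans hn
  rw [Real.enorm_eq_ofReal_abs, ENNReal.ofReal_le_ofReal_iff hε.le] at h1
  linarith [hmain n]

/-! ### Locally light tails -/

lemma summable_int_one_div_one_add_abs_sq :
    Summable fun k : ℤ => 1 / (1 + |(k : ℝ)|) ^ 2 := by
  have h : Summable fun n : ℕ => 1 / (1 + (n : ℝ)) ^ 2 := by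
    refine ((summable_nat_add_iff 1).2 (Real.summable_one_div_nat_pow.2 one_lt_two)).congr
      fun n => ?_
    push_cast
    rw [add_comm]
  refine Summable.of_nat_of_neg ?_ ?_
  · simpa using h
  · simpa using h

/-- Only the cell `k = ⌊x + u⌋` is used; there `1 + |k| ≤ 2 (1 + |x+u|)`, and `8 = 2³`. -/
lemma abs_shift_le_tsum {g : ℝ → ℝ} {C : ℝ} (hC : ∀ x, (1 + |x|) ^ 3 * |g x| ≤ C) (x u : ℝ) :
    ENNReal.ofReal ({u : ℝ | 1 < |u|}.indicator (fun u => |x| * |g (x + u)|) u)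
      ≤ ∑' k : ℤ, (Set.Icc (k - x - 1) (k - x + 1) \ Set.Icc (-1) 1).indicator
          (fun _ => ENNReal.ofReal (8 * C * |x| / (1 + |(k : ℝ)|) ^ 3)) u := by
  by_cases hu : 1 < |u|
  · refine le_trans ?_ (ENNReal.le_tsum ⌊x + u⌋)
    have h1 := Int.floor_le (x + u)
    have h2 := Int.lt_floor_add_one (x + u)
    have hmem : u ∈ Set.Icc ((⌊x + u⌋ : ℝ) - x - 1) (⌊x + u⌋ - x + 1) \ Set.Icc (-1) 1 :=
      ⟨⟨by linarith, by linarith⟩, fun h => absurd (abs_le.2 h) (not_le.2 hu)⟩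
    rw [Set.indicator_of_mem (show u ∈ {u : ℝ | 1 < |u|} from hu), Set.indicator_of_mem hmem]
    refine ENNReal.ofReal_le_ofReal ?_
    rw [le_div_iff₀ (by positivity)]
    have h3 : 1 + |(⌊x + u⌋ : ℝ)| ≤ 2 * (1 + |x + u|) := by
      have : |(⌊x + u⌋ : ℝ)| ≤ |x + u| + 1 :=
        abs_le.2 ⟨by linarith [neg_abs_le (x + u)], by linarith [le_abs_self (x + u)]⟩
      linarith [abs_nonneg (x + u)]
    calc |x| * |g (x + u)| * (1 + |(⌊x + u⌋ : ℝ)|) ^ 3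
        ≤ |x| * |g (x + u)| * (2 * (1 + |x + u|)) ^ 3 := by gcongr
      _ = 8 * ((1 + |x + u|) ^ 3 * |g (x + u)|) * |x| := by ring
      _ ≤ _ := by gcongr; exact hC _
  · rw [Set.indicator_of_notMem (show u ∉ {u : ℝ | 1 < |u|} from hu), ENNReal.ofReal_zero]
    exact zero_le

/-- Since `|x| ≤ |k| + |k - x|`, light tails bound `|x|` times the mass of the cell around `k - x`
by a constant times `1 + |k|`. Cubic decay of `g` leaves a series in `(1 + |k|)⁻²`, independent of
`x`. -/
lemma exists_setLIntegral_shift_bound {ν : Measure ℝ} (hν : IsLevyMeasure ν)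
    (hl : LocallyLightTails ν) {g : ℝ → ℝ} (hg : g ∈ steinClass) :
    ∃ K : ℝ, 0 ≤ K ∧ ∀ x, ∫⁻ u, ENNReal.ofReal
      ({u : ℝ | 1 < |u|}.indicator (fun u => |x| * |g (x + u)|) u) ∂ν ≤ ENNReal.ofReal K := by
  obtain ⟨C, hC0, hC⟩ := exists_decay_bound hg 3
  obtain ⟨L, hL⟩ := hl
  have hL0 : 0 ≤ L := le_trans (by positivity) (hL 0)
  set T := {u : ℝ | 1 < |u|} with hT
  have hTfin : ν T ≠ ⊤ := (hν.measure_lt_abs_lt_top one_pos).ne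
  have hcell : ∀ y : ℝ, Set.Icc (y - 1) (y + 1) \ Set.Icc (-1) 1 ⊆ T := fun y u hu => by
    by_contra h
    exact hu.2 (abs_le.1 (not_lt.1 h))
  have hs := summable_int_one_div_one_add_abs_sq.mul_left (8 * C * (L + ν.real T))
  refine ⟨∑' k : ℤ, 8 * C * (L + ν.real T) * (1 / (1 + |(k : ℝ)|) ^ 2),
    tsum_nonneg fun k => by positivity, fun x => ?_⟩
  have hms : ∀ k : ℤ, MeasurableSet (Set.Icc ((k : ℝ) - x - 1) (k - x + 1) \ Set.Icc (-1) 1) :=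
    fun k => measurableSet_Icc.diff measurableSet_Icc
  refine (lintegral_mono fun u => abs_shift_le_tsum hC x u).trans ?_
  rw [lintegral_tsum fun k => (measurable_const.indicator (hms k)).aemeasurable,
    ENNReal.ofReal_tsum_of_nonneg (fun k => by positivity) hs]
  refine ENNReal.tsum_le_tsum fun k => ?_
  have hfin := ne_top_of_le_ne_top hTfin (measure_mono (hcell (k - x)))
  rw [lintegral_indicator_const (hms k), ← ENNReal.ofReal_toReal hfin,
    ← ENNReal.ofReal_mul (by positivity)]
  refine ENNReal.ofReal_le_ofReal ?_
  have h1 := hL (k - x)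
  have h2 : ν.real (Set.Icc ((k : ℝ) - x - 1) (k - x + 1) \ Set.Icc (-1) 1) ≤ ν.real T :=
    measureReal_mono (hcell _) hTfin
  change _ * ν.real _ ≤ _
  set p := ν.real (Set.Icc ((k : ℝ) - x - 1) (k - x + 1) \ Set.Icc (-1) 1) with hp
  have hp0 : 0 ≤ p := measureReal_nonneg
  have h3 : |x| ≤ |(k : ℝ)| + |k - x| := by
    have := abs_sub (k : ℝ) (k - x)
    rwa [sub_sub_cancel] at this
  have h4 : |x| * p ≤ (1 + |(k : ℝ)|) * (L + ν.real T) := by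
    have hT0 : 0 ≤ ν.real T := measureReal_nonneg
    calc |x| * p ≤ (|(k : ℝ)| + |k - x|) * p := by gcongr
      _ = |(k : ℝ)| * p + |k - x| * p := by ring
      _ ≤ |(k : ℝ)| * ν.real T + L := by gcongr
      _ ≤ _ := by nlinarith [abs_nonneg (k : ℝ), mul_nonneg (abs_nonneg (k : ℝ)) hL0]
  have h5 : (0 : ℝ) < 1 + |(k : ℝ)| := by positivity
  calc 8 * C * |x| / (1 + |(k : ℝ)|) ^ 3 * p = 8 * C * (|x| * p) / (1 + |(k : ℝ)|) ^ 3 := by ring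
    _ ≤ 8 * C * ((1 + |(k : ℝ)|) * (L + ν.real T)) / (1 + |(k : ℝ)|) ^ 3 := by gcongr
    _ = _ := by field_simp

lemma exists_shiftPart_bound {ν : Measure ℝ} (hν : IsLevyMeasure ν)
    (h : Integrable (fun u => min 1 |u|) ν) (hl : LocallyLightTails ν) {g : ℝ → ℝ}
    (hg : g ∈ steinClass) : ∃ K : ℝ, ∀ x, |shiftPart ν g x| ≤ K := by
  obtain ⟨K, hK0, hK⟩ := exists_setLIntegral_shift_bound hν hl hg
  obtain ⟨C, hC0, hC⟩ := exists_decay_bound hg 1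
  have hmin : 0 ≤ ∫ u, min 1 |u| ∂ν := integral_nonneg fun u => by positivity
  refine ⟨C * ∫ u, min 1 |u| ∂ν + K, fun x => ?_⟩
  have hpt : ∀ u, ‖u * g (x + u)‖ₑ ≤ ENNReal.ofReal (C * min 1 |u|)
      + ENNReal.ofReal ({u : ℝ | 1 < |u|}.indicator (fun u => |x| * |g (x + u)|) u) := fun u => by
    rw [Real.enorm_eq_ofReal_abs, ← ENNReal.ofReal_add (by positivity)
      (Set.indicator_nonneg (fun _ _ => by positivity) _)]
    refine ENNReal.ofReal_le_ofReal ?_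
    rw [abs_mul]
    have h1 := hC (x + u)
    rw [pow_one] at h1
    rcases le_or_gt |u| 1 with hu | hu
    · rw [min_eq_right hu, Set.indicator_of_notMem
        (show u ∉ {u : ℝ | 1 < |u|} from not_lt.2 hu), add_zero, mul_comm]
      gcongr
      nlinarith [abs_nonneg (x + u), abs_nonneg (g (x + u))]
    · rw [min_eq_left hu.le, Set.indicator_of_mem (show u ∈ {u : ℝ | 1 < |u|} from hu), mul_one]
      have h3 : |u| ≤ |x + u| + |x| := by
        have := abs_sub (x + u) x
        rwa [add_sub_cancel_left] at this
      nlinarith [abs_nonneg (g (x + u))]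
  have hle : ‖shiftPart ν g x‖ₑ ≤ ENNReal.ofReal (C * ∫ u, min 1 |u| ∂ν + K) := by
    refine (enorm_integral_le_lintegral_enorm _).trans ((lintegral_mono hpt).trans ?_)
    rw [lintegral_add_left (by fun_prop), ENNReal.ofReal_add (by positivity) hK0,
      ← integral_const_mul, ofReal_integral_eq_lintegral_ofReal (h.const_mul C)
        (ae_of_all _ fun u => by positivity)]
    gcongr
    exact hK x
  rwa [Real.enorm_eq_ofReal_abs, ENNReal.ofReal_le_ofReal_iff (by positivity)] at hle

/-! ### Main theorem -/

lemma measurable_steinOpB (β : ℝ) (ν : Measure ℝ) [SFinite ν] {g : ℝ → ℝ} (hg : g ∈ steinClass) :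
    Measurable (steinOpB β ν g) := by
  have h1 := hg.1.continuous.measurable
  have h2 := measurable_shiftPart ν hg
  exact ((measurable_id.sub_const _).mul h1).sub h2

/-- The Stein operator of an infinitely divisible law of finite variation. -/
theorem IsIDD.steinOpB_spec {Ω : Type*} [MeasurableSpace Ω] {P : Measure Ω}
    [IsProbabilityMeasure P] {X : Ω → ℝ} {β σ : ℝ} {ν : Measure ℝ} (hX : IsIDD P X β σ ν)
    (hσ : σ ^ 2 = 0) (hs : IntegrableOn (fun u : ℝ => u) {u | |u| ≤ 1} ν)
    {g : ℝ → ℝ} (hg : g ∈ steinClass) :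
    (∀ x, Integrable (fun u => u * g (x + u)) ν) ∧
    (Integrable (fun w => steinOpB β ν g (X w)) P → ∫ w, steinOpB β ν g (X w) ∂P = 0) ∧
    (LocallyLightTails ν → Integrable (fun w => steinOpB β ν g (X w)) P) := by
  have hν := hX.levy
  have := hν.sigmaFinite
  have hprob : IsProbabilityMeasure (P.map X) := Measure.isProbabilityMeasure_map hX.aemeasurable
  have h := hν.integrable_min_one_abs hs
  have hm := (measurable_steinOpB β ν hg).aestronglyMeasurable (μ := P.map X)
  have hiff : Integrable (fun w => steinOpB β ν g (X w)) P
      ↔ Integrable (steinOpB β ν g) (P.map X) :=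
    (integrable_map_measure hm hX.aemeasurable).symm
  refine ⟨integrable_mul_shift h hg, fun hi => ?_, fun hl => hiff.2 ?_⟩
  · rw [← integral_map hX.aemeasurable hm]
    refine integral_stein_eq_zero hν h (fun t => ?_) hg (hiff.1 hi)
    rw [hX.charFun_eq, levyExponent_eq_drift hν hs hσ]
  · obtain ⟨K, hK⟩ := exists_shiftPart_bound hν h hl hg
    exact (integrable_sub_mul hg _ _).sub (Integrable.of_bound
      (measurable_shiftPart ν hg).aestronglyMeasurable K (ae_of_all _ hK))

theorem mainTheorem1 {Ω : Type*} [MeasurableSpace Ω] (P : Measure Ω) [IsProbabilityMeasure P]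
    (X : Ω → ℝ) (β σ : ℝ) (ν : Measure ℝ) (hX : IsIDD P X β σ ν) :
    -- (i) type A
    (ν Set.univ < ⊤ → σ ^ 2 = 0 → β - ∫ u in {u : ℝ | |u| ≤ 1}, u ∂ν = 0 →
      ∀ g ∈ steinClass,
        (∀ x, Integrable (fun u => u * g (x + u)) ν) ∧
        (Integrable (fun w => steinOpA ν g (X w)) P → ∫ w, steinOpA ν g (X w) ∂P = 0) ∧
        (LocallyLightTails ν → Integrable (fun w => steinOpA ν g (X w)) P)) ∧
    -- (ii) type B
    (ν Set.univ = ⊤ → σ ^ 2 = 0 → IntegrableOn (fun u : ℝ => u) {u | |u| ≤ 1} ν →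
      ∀ g ∈ steinClass,
        (∀ x, Integrable (fun u => u * g (x + u)) ν) ∧
        (Integrable (fun w => steinOpB β ν g (X w)) P → ∫ w, steinOpB β ν g (X w) ∂P = 0) ∧
        (LocallyLightTails ν → Integrable (fun w => steinOpB β ν g (X w)) P)) ∧
    -- (iii) type C, no Gaussian part
    (σ ^ 2 = 0 → ¬ IntegrableOn (fun u : ℝ => u) {u | |u| ≤ 1} ν →
      IntegrableOn (fun u : ℝ => u) {u | 1 < |u|} ν →
      ∀ g ∈ steinClass,
        (∀ x, Integrable (fun u => u * (g (x + u) - g x * smallJump u)) ν) ∧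
        Integrable (fun w => steinOpC β ν g (X w)) P ∧
        ∫ w, steinOpC β ν g (X w) ∂P = 0) ∧
    -- (iv) type C, Gaussian
    (ν = 0 → 0 < σ ^ 2 →
      ∀ g ∈ steinClass,
        Integrable (fun w => steinOpGauss β σ g (X w)) P ∧
        ∫ w, steinOpGauss β σ g (X w) ∂P = 0) := by
  have hν := hX.levy
  have := hν.sigmaFinite
  have hprob : IsProbabilityMeasure (P.map X) := Measure.isProbabilityMeasure_map hX.aemeasurable
  refine ⟨fun hfin hσ hd g hg => ?_, fun _ hσ hs g hg => hX.steinOpB_spec hσ hs hg,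
    fun hσ _ hbig g hg => ?_, fun hν0 _ g hg => ?_⟩
  · have hf : IsFiniteMeasure ν := ⟨hfin⟩
    have hs : IntegrableOn (fun u : ℝ => u) {u | |u| ≤ 1} ν :=
      (integrable_const (1 : ℝ)).mono' (by fun_prop)
        ((ae_restrict_iff' (measurableSet_abs_le 1)).2 (ae_of_all _ fun _ hu => hu))
    -- Type A is the zero-drift case of the type B operator, whose analysis does not use `ν(ℝ) = ∞`.
    have e : steinOpA ν g = steinOpB β ν g := funext fun x => by
      rw [steinOpA, steinOpB, levyDrift, hd, sub_zero]
    rw [e]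
    exact hX.steinOpB_spec hσ hs hg
  · have hw := hν.integrable_jumpWeight hbig
    have h1 := integrable_sub_mul hg β (P.map X)
    have h2 := integrable_jumpPart hw hg (P.map X)
    have h3 : Integrable (steinOpC β ν g) (P.map X) := h1.sub h2
    refine ⟨integrable_jump_increment hw hg,
      (integrable_map_measure h3.aestronglyMeasurable hX.aemeasurable).1 h3, ?_⟩
    rw [← integral_map hX.aemeasurable h3.aestronglyMeasurable]
    have key := stein_identity hν hw hX.charFun_eq hg
    rw [hσ, zero_mul, zero_add] at key
    exact (integral_sub h1 h2).trans (sub_eq_zero.2 key)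
  · have hw : Integrable jumpWeight ν := by rw [hν0]; exact integrable_zero_measure
    have h1 := integrable_sub_mul hg β (P.map X)
    have h2 := (integrable_deriv_steinClass hg (P.map X)).const_mul (σ ^ 2)
    have h3 : Integrable (steinOpGauss β σ g) (P.map X) := h1.sub h2
    refine ⟨(integrable_map_measure h3.aestronglyMeasurable hX.aemeasurable).1 h3, ?_⟩
    rw [← integral_map hX.aemeasurable h3.aestronglyMeasurable]
    have key := stein_identity hν hw hX.charFun_eq hg
    have hj : jumpPart ν g = 0 := funext fun x => by rw [jumpPart, hν0, integral_zero_measure]; rfl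
    rw [hj, ← integral_const_mul] at key
    simp only [Pi.zero_apply, integral_zero, add_zero] at key
    exact (integral_sub h1 h2).trans (sub_eq_zero.2 key)
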